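/- Throughout, $\mathbb{N}=\{1,2,3,\dots\}$, $[L]=\{1,\dots,L\}$, $e(x)=e^{2\pi i x}$, $\|x\|_{\mathbb{T}}$ is the distance from $x\in\mathbb{R}$ to the nearest integer, and $d(A)=\lim_{n\to\infty}|A\cap[n]|/n$ is the natural density. For sequences $\mathbf{N}=(N_s)$, $\mathbf{H}=(H_s)$ of positive integers, $1\prec\mathbf{H}$ means $H_s\to\infty$, $\mathbf{H}\prec\mathbf{N}$ means $H_s/N_s\to0$; put $N_0=0$. **Definitions.** For a finite abelian group $G$ and $f:G\to\mathbb{C}$, let $\|f\|_{U^2(G)}=\big(|G|^{-3}\sum_{x,h_1,h_2\in G}f(x)\overline{f(x+h_1)}\,\overline{f(x+h_2)}f(x+h_1+h_2)\big)^{1/4}$. For $f:\mathbb{N}\to\mathbb{C}$, let $\|f\|_{U^2(\{x+1,\dots,x+L\})}=\|\tilde f\|_{U^2(\mathbb{Z}/\tilde L\mathbb{Z})}/\|1_{[L]}\|_{U^2(\mathbb{Z}/\tilde L\mathbb{Z})}$, where $\tilde L\ge 4L$ (the value does not depend on $\tilde L$) and $\tilde f(n)=1_{[L]}(n)f(x+n)$.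 For bounded $f$ let $$\|f\|_{U^2(\mathbf{N},\mathbf{H})}=\lim_{s\to\infty}\frac1{N_s-H_s+1}\sum_{n=1}^{N_s-H_s+1}\|f\|_{U^2(\{n,\dots,n+H_s-1\})}$$ when the limit exists. Write $\mathbb{E}_{n\in\mathbf{N}}f(n)=\lim_{s\to\infty}\frac1{N_s}\sum_{n\le N_s}f(n)$ and $\|f\|_{2,\mathbf{N}}=(\mathbb{E}_{n\in\mathbf{N}}|f(n)|^2)^{1/2}$ when the limits exist. Let $1\prec\mathbf{H}\prec\mathbf{N}$. The pair $(\mathbf{N},\mathbf{H})$ is a *$U^2$ good scale* for a set $A\subseteq\mathbb{N}$ if $1_A=f_{\mathrm{str}}+f_{\mathrm{unf}}$ where: (i) $f_{\mathrm{str}}:\mathbb{N}\to[0,1]$ and $\mathbb{E}_{n\in\mathbf{N}}f_{\mathrm{unf}}(n)=0$; (ii) for every $\epsilon>0$ there are $d$, functions $c_1,\dots,c_d:\mathbb{N}\to\mathbb{C}$ with $|c_i|\le1$ and $\alpha_1,\dots,\alpha_d:\mathbb{N}\to\mathbb{R}$ such that $\mathcal{P}(n)=\sum_i c_i(n)e(n\alpha_i(n))$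 satisfies $\|\mathcal{P}-f_{\mathrm{str}}\|_{2,\mathbf{N}}\le\epsilon$ and, for every real $C\ge1$, each of the following three subsets of $[N_s-H_s+1]$ has cardinality $(1-o_{s\to\infty}(1))(N_s-H_s+1)$: the set of $n$ such that every $\alpha_i$ is constant on $\{n+1,\dots,n+H_s\}$; the set of $n$ such that every $c_i$ is constant on $\{n+1,\dots,n+H_s\}$; the set of $n$ such that for all $w\in[-C,C]^d\cap\mathbb{Z}^d$ either $\|\sum_iw_i\alpha_i(n)\|_{\mathbb{T}}\le\frac1{CH_s}$ or $\|\sum_iw_i\alpha_i(n)\|_{\mathbb{T}}\ge\frac{C}{H_s}$; (iii) there is $\mathbf{H}'$ with $1\prec\mathbf{H}'\prec\mathbf{H}$ and $\|f_{\mathrm{unf}}\|_{U^2(\mathbf{N},\mathbf{H}')}=0$. For $E,F\subseteq\mathbb{Z}$ let $E+_{\bmod Q}F\subseteq\{0,\dots,Q-1\}$ be the set of residues mod $Q$ of the elements of $E+F$. A set $B\subseteq\mathbb{N}$ *meets every residue class in $\mathbb{N}$* if $B\cap(a\mathbb{N}+b)\ne\emptyset$ for all $a,b\in\mathbb{N}$.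 **Theorem.** Let $A\subseteq\mathbb{N}$ be such that $d(A)$ exists and is positive, and let $\mathbf{N},\mathbf{H}$ be sequences of positive integers with $1\prec\mathbf{H}\prec\mathbf{N}$ and $\lim_{s\to\infty}N_s/N_{s+1}=0$. If $(\mathbf{N},\mathbf{H})$ is a $U^2$ good scale for $A$, then there exist a sequence $\epsilon_s\to0$ and, for every $n\in\mathbb{N}$, a positive integer $Q_n$ such that $H_s\le Q_n\le(1+\epsilon_s)H_s$ whenever $n\in\{N_{s-1}+1,\dots,N_s\}$, such that $\lim_{n\to\infty}\min\{m\in\mathbb{N}:m\nmid Q_n\}=\infty$, and such that the following holds. For any choice of sets $\tilde B_s\subseteq[H_s]$ ($s\in\mathbb{N}$), for all $s$ and all but $o_{s\to\infty}(N_s)$ many $n\in\{N_{s-1}+1,\dots,N_s\}$, there exist sets $A_n\subseteq(A-n)\cap\{0,\dots,Q_n-1\}$ and $B_n\subseteq\tilde B_s$ with (I) $|((A-n)\cap\{0,\dots,Q_n-1\})\setminus A_n|\le\epsilon_sQ_n$, (II) $|\tilde B_s\setminus B_n|\le\epsilon_sQ_n$, (III) $|(A_n+_{\bmod Q_n}B_n)\setminus((A+\tilde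 B_s-n)\cap\{0,\dots,Q_n-1\})|\le\epsilon_sQ_n$. Moreover, if $\tilde B_s=B\cap[H_s]$ for all $s$, where $B\subseteq\mathbb{N}$ meets every residue class in $\mathbb{N}$, then there exists a sequence of integers $D_s\to\infty$ such that, for all $s$ and all but $o_{s\to\infty}(N_s)$ many $n\in\{N_{s-1}+1,\dots,N_s\}$, the sets $A_n,B_n$ satisfying (I)–(III) may be chosen so that in addition (IV) $B_n$ meets every residue class mod $m$ for every $m\le D_s$. -/

import Mathlib

open Filter Topology
open scoped Pointwise

noncomputable section

namespace LocalSumset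

/-! Positive integers are the set of values and of arguments that matter: for a function on `ℕ` only
the values at `n ≥ 1` enter, and `[n]` is `Set.Icc 1 n`.  Sequences `(N_s)`, `(H_s)` are indexed
by `s = 0, 1, 2, …`, so that `N 0` is the first term. -/

/-- The natural density `d(A)` exists and equals `δ`. -/
def HasDensity (A : Set ℕ) (δ : ℝ) : Prop :=
  Tendsto (fun n : ℕ => ((A ∩ Set.Icc 1 n).ncard : ℝ) / n) atTop (𝓝 δ)

/-- `a ≺ b`: `a_s / b_s → 0`. -/
def Prec (a b : ℕ → ℕ) : Prop :=
  Tendsto (fun s => (a s : ℝ) / (b s : ℝ)) atTop (𝓝 0)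

/-- The term before the `s`-th term of `N`, with the convention that the first term is preceded
by `0`. -/
def prevTerm (N : ℕ → ℕ) : ℕ → ℕ
  | 0 => 0
  | s + 1 => N s

/-- The `s`-th block `{N_{s-1} + 1, …, N_s}`. -/
def block (N : ℕ → ℕ) (s : ℕ) : Set ℕ := Set.Ioc (prevTerm N s) (N s)

/-- For every `s`, all but `o(N_s)` many `n` in the `s`-th block satisfy `P s n`. -/
def ForAlmostAll (N : ℕ → ℕ) (P : ℕ → ℕ → Prop) : Prop :=
  Tendsto (fun s => ({n | n ∈ block N s ∧ ¬ P s n}.ncard : ℝ) / (N s : ℝ)) atTop (𝓝 0)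

/-! ### Gowers `U²` norms -/

/-- The Gowers `U²` norm on a finite abelian group.  The sum is a nonnegative real number, so that
it coincides with its absolute value. -/
def gowersU2 {G : Type*} [AddCommGroup G] [Fintype G] (f : G → ℂ) : ℝ :=
  ‖(∑ x : G, ∑ h₁ : G, ∑ h₂ : G,
      f x * (starRingEnd ℂ) (f (x + h₁)) * (starRingEnd ℂ) (f (x + h₂)) * f (x + h₁ + h₂))
    / ((Fintype.card G : ℂ) ^ 3)‖ ^ (1 / 4 : ℝ)

/-- The function `n ↦ 1_{[L]}(n) f(x + n)` on `ℤ/Mℤ`. -/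
def truncate (f : ℕ → ℂ) (x L M : ℕ) : ZMod M → ℂ :=
  fun n => if 1 ≤ n.val ∧ n.val ≤ L then f (x + n.val) else 0

/-- The Gowers `U²` seminorm over the interval `{x+1, …, x+L}`.  The interval is embedded in a
cyclic group of order at least `4L`; the value does not depend on which one. -/
def gowersU2Interval (f : ℕ → ℂ) (x L : ℕ) : ℝ :=
  gowersU2 (truncate f x L (4 * L + 1)) / gowersU2 (truncate (fun _ => 1) 0 L (4 * L + 1))

/-- The limit that defines `‖f‖_{U²(N,H)}` exists and equals `c`:
the average over `n ∈ [N_s - H_s + 1]` of the `U²` seminorms over `{n, …, n + H_s - 1}` tends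
to `c`.  (`N_s + 1 - H_s` is a truncated subtraction, exact when `H_s ≤ N_s`.) -/
def HasU2Seminorm (N H : ℕ → ℕ) (f : ℕ → ℂ) (c : ℝ) : Prop :=
  Tendsto (fun s => (∑ n ∈ Finset.Icc 1 (N s + 1 - H s), gowersU2Interval f (n - 1) (H s))
    / ((N s + 1 - H s : ℕ) : ℝ)) atTop (𝓝 c)

/-! ### `U²` good scales -/

/-- The average `𝔼_{n ∈ N} f(n)` exists and equals `c`. -/
def HasMeanAlong (N : ℕ → ℕ) (f : ℕ → ℝ) (c : ℝ) : Prop :=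
  Tendsto (fun s => (∑ n ∈ Finset.Icc 1 (N s), f n) / (N s : ℝ)) atTop (𝓝 c)

/-- The norm `‖f‖_{2,N} = (𝔼_{n ∈ N} |f(n)|²)^{1/2}` is well defined and equals `c`. -/
def HasL2NormAlong (N : ℕ → ℕ) (f : ℕ → ℂ) (c : ℝ) : Prop :=
  ∃ v : ℝ, HasMeanAlong N (fun n => ‖f n‖ ^ 2) v ∧ c = Real.sqrt v

/-- `e(x) = exp(2πix)`. -/
def e (x : ℝ) : ℂ := Complex.exp (2 * Real.pi * Complex.I * x)

/-- The function `𝒫(n) = ∑ᵢ cᵢ(n) e(n αᵢ(n))`. -/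
def localTrigPoly {d : ℕ} (c : Fin d → ℕ → ℂ) (α : Fin d → ℕ → ℝ) (n : ℕ) : ℂ :=
  ∑ i, c i n * e (n * α i n)

/-- The proportion of elements of `[N_s - H_s + 1]` that belong to `S s` tends to `1`. -/
def FullProportion (N H : ℕ → ℕ) (S : ℕ → Set ℕ) : Prop :=
  Tendsto (fun s => ((S s ∩ Set.Icc 1 (N s + 1 - H s)).ncard : ℝ) / ((N s + 1 - H s : ℕ) : ℝ))
    atTop (𝓝 1)

/-- The `n` such that each of the `d` functions `gᵢ` is constant on `{n+1, …, n+L}`. -/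
def constancySet {R : Type*} {d : ℕ} (g : Fin d → ℕ → R) (L : ℕ) : Set ℕ :=
  {n | ∀ i, ∀ m₁ ∈ Set.Icc 1 L, ∀ m₂ ∈ Set.Icc 1 L, g i (n + m₁) = g i (n + m₂)}

/-- The `n` such that for all integer vectors `w ∈ [-C, C]^d` the distance from `∑ᵢ wᵢ αᵢ(n)` to the
nearest integer is at most `1/(C L)` or at least `C/L`. -/
def dichotomySet {d : ℕ} (α : Fin d → ℕ → ℝ) (C : ℝ) (L : ℕ) : Set ℕ :=
  {n | ∀ w : Fin d → ℤ, (∀ i, |(w i : ℝ)| ≤ C) →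
    ‖((∑ i, (w i : ℝ) * α i n : ℝ) : UnitAddCircle)‖ ≤ 1 / (C * L) ∨
    C / L ≤ ‖((∑ i, (w i : ℝ) * α i n : ℝ) : UnitAddCircle)‖}

/-- `(N, H)` is a `U²` good scale for `f : ℕ → [0,1]`, where `1 ≺ H ≼ N`. -/
def IsU2GoodScale (N H : ℕ → ℕ) (f : ℕ → ℝ) : Prop :=
  ∃ fstr funf : ℕ → ℝ, (∀ n, f n = fstr n + funf n) ∧
    -- nonnegativity
    ((∀ n, fstr n ∈ Set.Icc (0 : ℝ) 1) ∧ HasMeanAlong N funf 0) ∧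
    -- structure
    (∀ ε : ℝ, 0 < ε → ∃ (d : ℕ) (c : Fin d → ℕ → ℂ) (α : Fin d → ℕ → ℝ),
      (∀ i n, ‖c i n‖ ≤ 1) ∧
      (∃ v ≤ ε, HasL2NormAlong N (fun n => localTrigPoly c α n - (fstr n : ℂ)) v) ∧
      (∀ C : ℝ, 1 ≤ C →
        FullProportion N H (fun s => constancySet α (H s)) ∧
        FullProportion N H (fun s => constancySet c (H s)) ∧
        FullProportion N H (fun s => dichotomySet α C (H s)))) ∧
    -- uniformity
    (∃ H' : ℕ → ℕ, (∀ s, 0 < H' s) ∧ Prec (fun _ => 1) H' ∧ Prec H' H ∧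
      HasU2Seminorm N H' (fun n => (funf n : ℂ)) 0)

/-- `(N, H)` is a `U²` good scale for the set `A`, that is, for its indicator function. -/
def IsU2GoodScaleForSet (N H : ℕ → ℕ) (A : Set ℕ) : Prop :=
  IsU2GoodScale N H (A.indicator fun _ => (1 : ℝ))

/-! ### Local sumsets -/

/-- `(A - n) ∩ {0, 1, …, Q - 1}`. -/
def window (A : Set ℕ) (n Q : ℕ) : Set ℕ := {x | x < Q ∧ n + x ∈ A}

/-- The sumset `E + F` reduced mod `Q`, a subset of `{0, 1, …, Q - 1}` for `Q ≥ 1`. -/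
def sumMod (Q : ℕ) (E F : Set ℕ) : Set ℕ := {z | ∃ x ∈ E, ∃ y ∈ F, z = (x + y) % Q}

/-- `lim_{n → ∞} min {m ≥ 1 : m ∤ Q_n} = ∞`. -/
def HighlyDivisible (Q : ℕ → ℕ) : Prop :=
  Tendsto (fun n => sInf {m : ℕ | 0 < m ∧ ¬ m ∣ Q n}) atTop atTop

/-- `B` meets every residue class in the positive integers: `B ∩ (aℕ + b) ≠ ∅` for all positive
integers `a, b`, where `ℕ = {1, 2, 3, …}`. -/
def MeetsEveryResidueClass (B : Set ℕ) : Prop :=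
  ∀ a b : ℕ, 0 < a → 0 < b → ∃ k : ℕ, 0 < k ∧ a * k + b ∈ B

/-- `E` meets every residue class mod `m` for every positive integer `m ≤ D`. -/
def MeetsResidueClassesUpTo (E : Set ℕ) (D : ℕ) : Prop :=
  ∀ m : ℕ, 0 < m → m ≤ D → ∀ r : ℕ, ∃ b ∈ E, b ≡ r [MOD m]

/-- `A'` and `B'` are subsets of `(A - n) ∩ {0, …, Q - 1}` and of `B` that omit at most `εQ` elements
of these sets, and all but at most `εQ` elements of `A' + B'` mod `Q` lie in
`(A + B - n) ∩ {0, …, Q - 1}`. -/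
def IsLocalSumsetPair (A B : Set ℕ) (n Q : ℕ) (ε : ℝ) (A' B' : Set ℕ) : Prop :=
  A' ⊆ window A n Q ∧ B' ⊆ B ∧
    ((window A n Q \ A').ncard : ℝ) ≤ ε * Q ∧
    ((B \ B').ncard : ℝ) ≤ ε * Q ∧
    ((sumMod Q A' B' \ window (A + B) n Q).ncard : ℝ) ≤ ε * Q

end LocalSumset

end

open LocalSumset

noncomputable section

namespace LocalSumset

section Removal

open SimpleGraph TripartiteFromTriangles Finset

variable {G : Type} [AddCommGroup G] [Fintype G] [DecidableEq G]

/-- The triangles `(x, x + a, x + a + b)` attached to a set of pairs `(a, b)`. -/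
def sumTriangles (T : Finset (G × G)) : Finset (G × G × G) :=
  (univ ×ˢ T).image fun p => (p.1, p.1 + p.2.1, p.1 + p.2.1 + p.2.2)

lemma mem_sumTriangles {T : Finset (G × G)} {x y w : G} :
    (x, y, w) ∈ sumTriangles T ↔ (y - x, w - y) ∈ T := by
  simp only [sumTriangles, mem_image, mem_product, mem_univ, true_and, Prod.mk.injEq, Prod.exists]
  constructor
  · rintro ⟨z, a, b, hab, rfl, rfl, rfl⟩
    simpa using hab
  · intro h
    exact ⟨x, _, _, h, rfl, by abel, by abel⟩

lemma card_sumTriangles (T : Finset (G × G)) : #(sumTriangles T) = Fintype.card G * #T := by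
  rw [sumTriangles, card_image_of_injective, card_product, card_univ]
  rintro ⟨x, a, b⟩ ⟨x', a', b'⟩ h
  simp only [Prod.mk.injEq] at h ⊢
  obtain ⟨rfl, h1, h2⟩ := h
  have h1 := add_left_cancel h1
  subst h1
  exact ⟨rfl, rfl, add_left_cancel h2⟩

/-- A family of pairs in which no two members agree in their first entry, in their second entry or
in their sum. -/
def IsSumMatching (T : Finset (G × G)) : Prop :=
  ∀ p ∈ T, ∀ q ∈ T, p.1 = q.1 ∨ p.2 = q.2 ∨ p.1 + p.2 = q.1 + q.2 → p = q

lemma explicitDisjoint_sumTriangles {T : Finset (G × G)} (hT : IsSumMatching T) :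
    ExplicitDisjoint (sumTriangles T) where
  inj₀ a b c a' h h' := by
    rw [mem_sumTriangles] at h h'
    have := congrArg Prod.fst (hT _ h _ h' (Or.inr (Or.inl rfl)))
    simpa using this
  inj₁ a b c b' h h' := by
    rw [mem_sumTriangles] at h h'
    have := congrArg Prod.fst (hT _ h _ h' (Or.inr (Or.inr (by simp))))
    simpa using this
  inj₂ a b c c' h h' := by
    rw [mem_sumTriangles] at h h'
    have := congrArg Prod.snd (hT _ h _ h' (Or.inl rfl))
    simpa using this

lemma card_cliqueFinset_sumTriangles_le {T : Finset (G × G)} {X Y Z : Finset G}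
    (hT : T ⊆ {p ∈ X ×ˢ Y | p.1 + p.2 ∈ Z}) :
    #((graph (sumTriangles T)).cliqueFinset 3) ≤
      Fintype.card G * #{p ∈ X ×ˢ Y | p.1 + p.2 ∈ Z} := by
  rw [← card_sumTriangles, ← card_map toTriangle]
  refine card_le_card fun s hs => ?_
  rw [mem_cliqueFinset_iff, SimpleGraph.is3Clique_iff] at hs
  obtain ⟨u, v, w, huv, huw, hvw, rfl⟩ := hs
  obtain ⟨x, y, z, hs, hxy, hxz, hyz⟩ := graph_triple huv huw hvw
  simp only [Graph.in₀₁_iff, Graph.in₀₂_iff, Graph.in₁₂_iff, mem_sumTriangles] at hxy hxz hyz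
  obtain ⟨c, hc⟩ := hxy
  obtain ⟨b, hb⟩ := hxz
  obtain ⟨a, ha⟩ := hyz
  have hc := hT hc
  have hb := hT hb
  have ha := hT ha
  simp only [mem_filter, mem_product] at hc hb ha
  refine mem_map.2 ⟨(x, y, z), ?_, hs⟩
  rw [mem_sumTriangles]
  simp only [mem_filter, mem_product]
  refine ⟨⟨hc.1.1, ha.1.2⟩, ?_⟩
  have := hb.2
  rwa [show b - x + (z - b) = y - x + (z - y) by abel] at this

/-- The arithmetic removal lemma for the equation `x + y = z` in a finite abelian group. -/
theorem exists_arithmetic_removal {ε : ℝ} (hε : 0 < ε) :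
    ∃ κ : ℝ, 0 < κ ∧ ∀ (G : Type) [AddCommGroup G] [Fintype G] [DecidableEq G] (X Y Z : Finset G),
      (#{p ∈ X ×ˢ Y | p.1 + p.2 ∈ Z} : ℝ) ≤ κ * (Fintype.card G : ℝ) ^ 2 →
      ∃ X' ⊆ X, ∃ Y' ⊆ Y, ∃ Z' ⊆ Z,
        (#(X \ X') : ℝ) ≤ ε * Fintype.card G ∧ (#(Y \ Y') : ℝ) ≤ ε * Fintype.card G ∧
        (#(Z \ Z') : ℝ) ≤ ε * Fintype.card G ∧ ∀ x ∈ X', ∀ y ∈ Y', x + y ∉ Z' := by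
  refine ⟨triangleRemovalBound (ε / 9), triangleRemovalBound_pos (by positivity), ?_⟩
  intro G _ _ _ X Y Z hfew
  classical
  set S : Finset (G × G) := {p ∈ X ×ˢ Y | p.1 + p.2 ∈ Z} with hS
  obtain ⟨T, hTmem, hTmax⟩ := exists_max_image {T ∈ S.powerset | IsSumMatching T} card
    ⟨∅, by simp [IsSumMatching]⟩
  simp only [mem_filter, mem_powerset, and_imp] at hTmem hTmax
  obtain ⟨hTS, hTm⟩ := hTmem
  have hcard : (#T : ℝ) ≤ ε * Fintype.card G := by
    by_contra! hlt
    have hG : (0 : ℝ) < Fintype.card G := by exact_mod_cast Fintype.card_pos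
    have := explicitDisjoint_sumTriangles hTm
    have hfar : (graph (sumTriangles T)).FarFromTriangleFree (ε / 9) := by
      apply farFromTriangleFree
      rw [card_sumTriangles]
      push_cast
      nlinarith
    have h1 := hfar.le_card_cliqueFinset
    have h2 : (#((graph (sumTriangles T)).cliqueFinset 3) : ℝ) ≤ Fintype.card G * #S := by
      exact_mod_cast card_cliqueFinset_sumTriangles_le hTS
    have h3 := h1.trans h2
    have hb : 0 < triangleRemovalBound (ε / 9) := triangleRemovalBound_pos (by positivity)
    simp only [Fintype.card_sum] at h3
    push_cast at h3
    have h4 := mul_le_mul_of_nonneg_left hfew hG.le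
    have h5 : 0 < triangleRemovalBound (ε / 9) * (Fintype.card G : ℝ) ^ 3 := by positivity
    nlinarith
  have hle : ∀ (W : Finset G) (f : G × G → G), (#(W \ (W \ T.image f)) : ℝ) ≤
      ε * Fintype.card G := fun W f => by
    refine le_trans ?_ hcard
    have : #(W \ (W \ T.image f)) ≤ #T := by
      refine le_trans (card_le_card ?_) (card_image_le (f := f))
      intro x hx
      simp only [Finset.mem_sdiff, not_and, not_not] at hx
      exact hx.2 hx.1
    exact_mod_cast this
  refine ⟨X \ T.image Prod.fst, sdiff_subset, Y \ T.image Prod.snd, sdiff_subset,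
    Z \ T.image (fun p => p.1 + p.2), sdiff_subset, hle _ _, hle _ _, hle _ _, ?_⟩
  intro x hx y hy hz
  simp only [Finset.mem_sdiff, mem_image, not_exists, not_and] at hx hy hz
  have hxy : (x, y) ∉ T := fun h => hx.2 _ h rfl
  have hm : IsSumMatching (insert (x, y) T) := by
    have key : ∀ p ∈ T, ¬ (p.1 = x ∨ p.2 = y ∨ p.1 + p.2 = x + y) := by
      rintro p hp (h | h | h)
      exacts [hx.2 p hp h, hy.2 p hp h, hz.2 p hp h]
    intro p hp q hq h
    rw [mem_insert] at hp hq
    rcases hp with rfl | hp <;> rcases hq with rfl | hq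
    · rfl
    · exact absurd (by simpa [eq_comm] using h) (key q hq)
    · exact absurd h (key p hp)
    · exact hTm p hp q hq h
  have := hTmax (insert (x, y) T)
    (insert_subset (by simp [hS, hx.1, hy.1, hz.1]) hTS) hm
  rw [card_insert_of_notMem hxy] at this
  omega

end Removal

section Gowers

open Finset

variable {G : Type*} [AddCommGroup G] [Fintype G]

/-- The autocorrelation `r ↦ ∑ₓ f(x) conj f(x + r)`. -/
def autocorr (f : G → ℂ) (r : G) : ℂ := ∑ x, f x * (starRingEnd ℂ) (f (x + r))

lemma sum_gowers_eq (f : G → ℂ) :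
    ∑ x : G, ∑ h₁ : G, ∑ h₂ : G,
      f x * (starRingEnd ℂ) (f (x + h₁)) * (starRingEnd ℂ) (f (x + h₂)) * f (x + h₁ + h₂)
      = ((∑ r, ‖autocorr f r‖ ^ 2 : ℝ) : ℂ) := by
  rw [Finset.sum_comm]
  push_cast
  refine sum_congr rfl fun r _ => ?_
  rw [← Complex.mul_conj']
  rw [autocorr, map_sum, sum_mul_sum]
  refine sum_congr rfl fun x _ => ?_
  conv_rhs => rw [← Equiv.sum_comp (Equiv.addLeft x)]
  refine sum_congr rfl fun h _ => ?_
  simp only [Equiv.coe_addLeft, map_mul, Complex.conj_conj]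
  rw [add_right_comm x h r]
  ring

lemma gowersU2_nonneg (f : G → ℂ) : 0 ≤ gowersU2 f := by
  unfold gowersU2; positivity

lemma gowersU2_pow_four (f : G → ℂ) :
    gowersU2 f ^ 4 = (∑ r, ‖autocorr f r‖ ^ 2) / (Fintype.card G : ℝ) ^ 3 := by
  unfold gowersU2
  rw [sum_gowers_eq, ← Real.rpow_natCast, ← Real.rpow_mul (norm_nonneg _), norm_div,
    Complex.norm_real, norm_pow, Complex.norm_natCast,
    Real.norm_of_nonneg (sum_nonneg fun _ _ => by positivity)]
  norm_num

lemma gowersU2_pow_four_mul (f : G → ℂ) :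
    gowersU2 f ^ 4 * (Fintype.card G : ℝ) ^ 3 = ∑ r, ‖autocorr f r‖ ^ 2 := by
  rw [gowersU2_pow_four, div_mul_cancel₀]
  have : (0 : ℝ) < Fintype.card G := by exact_mod_cast Fintype.card_pos
  positivity

lemma gowersU2_le_one {f : G → ℂ} (hf : ∀ x, ‖f x‖ ≤ 1) : gowersU2 f ≤ 1 := by
  have hG : (0 : ℝ) < Fintype.card G := by exact_mod_cast Fintype.card_pos
  have h : ∀ r, ‖autocorr f r‖ ≤ Fintype.card G := fun r => by
    refine (norm_sum_le _ _).trans ?_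
    refine (sum_le_card_nsmul univ _ 1 fun x _ => ?_).trans (by simp)
    rw [norm_mul, RCLike.norm_conj]
    exact mul_le_one₀ (hf _) (norm_nonneg _) (hf _)
  have h4 : gowersU2 f ^ 4 ≤ 1 := by
    rw [gowersU2_pow_four, div_le_one (by positivity)]
    refine (sum_le_card_nsmul univ _ ((Fintype.card G : ℝ) ^ 2) fun r _ => ?_).trans ?_
    · exact pow_le_pow_left₀ (norm_nonneg _) (h r) 2
    · rw [card_univ, nsmul_eq_mul]; exact le_of_eq (by ring)
  by_contra! hlt
  exact absurd h4 (not_le.2 (one_lt_pow₀ hlt (by norm_num)))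

lemma gowersU2_pos {f : G → ℂ} (x : G) (hx : f x ≠ 0) : 0 < gowersU2 f := by
  have hG : (0 : ℝ) < Fintype.card G := by exact_mod_cast Fintype.card_pos
  have h0 : autocorr f 0 = ((∑ y, ‖f y‖ ^ 2 : ℝ) : ℂ) := by
    simp only [autocorr, add_zero]
    push_cast
    exact sum_congr rfl fun y _ => Complex.mul_conj' _
  have h1 : 0 < ∑ y, ‖f y‖ ^ 2 :=
    sum_pos' (fun _ _ => by positivity) ⟨x, mem_univ _, by positivity⟩
  have h2 : 0 < ∑ r, ‖autocorr f r‖ ^ 2 := by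
    refine sum_pos' (fun _ _ => by positivity) ⟨0, mem_univ _, ?_⟩
    have : autocorr f 0 ≠ 0 := by rw [h0]; exact_mod_cast h1.ne'
    positivity
  rw [← gowersU2_pow_four_mul] at h2
  rcases (gowersU2_nonneg f).lt_or_eq with h | h
  · exact h
  · rw [← h] at h2; simp at h2

lemma sum_norm_sq_conv_eq {ι : Type*} (I : Finset ι) (a : ι → ℂ) (p : ι → G) (h : G → ℂ) :
    ((∑ y, ‖∑ i ∈ I, a i * h (p i - y)‖ ^ 2 : ℝ) : ℂ) =
      ∑ i ∈ I, ∑ j ∈ I, a i * (starRingEnd ℂ) (a j) * autocorr h (p j - p i) := by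
  push_cast
  simp_rw [← Complex.mul_conj', map_sum, sum_mul_sum]
  rw [Finset.sum_comm]
  refine sum_congr rfl fun i _ => ?_
  rw [Finset.sum_comm]
  refine sum_congr rfl fun j _ => ?_
  rw [autocorr, mul_sum, ← Equiv.sum_comp (Equiv.subLeft (p i))]
  refine sum_congr rfl fun y _ => ?_
  simp only [Equiv.subLeft_apply, map_mul, sub_sub_cancel]
  rw [show p j - (p i - y) = y + (p j - p i) by abel]
  ring

/-- The box form of the Gowers–Cauchy–Schwarz inequality. -/
lemma norm_sum_box_pow_four_le {ι κ : Type*} (I : Finset ι) (J : Finset κ) (a : ι → ℂ) (b : κ → ℂ)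
    (ha : ∀ i, ‖a i‖ ≤ 1) (hb : ∀ j, ‖b j‖ ≤ 1) (p : ι → G) (q : κ → G) (hp : Set.InjOn p I)
    (hq : Set.InjOn q J) (h : G → ℂ) :
    ‖∑ i ∈ I, ∑ j ∈ J, a i * b j * h (p i - q j)‖ ^ 4 ≤
      (#J : ℝ) ^ 2 * (#I : ℝ) ^ 3 * (gowersU2 h ^ 4 * (Fintype.card G : ℝ) ^ 3) := by
  classical
  set V : ℝ := ∑ y, ‖∑ i ∈ I, a i * h (p i - y)‖ ^ 2 with hV
  have hV0 : 0 ≤ V := by positivity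
  have h1 : ‖∑ i ∈ I, ∑ j ∈ J, a i * b j * h (p i - q j)‖ ^ 2 ≤ #J * V := by
    have e1 : ∑ i ∈ I, ∑ j ∈ J, a i * b j * h (p i - q j) =
        ∑ j ∈ J, b j * ∑ i ∈ I, a i * h (p i - q j) := by
      rw [Finset.sum_comm]
      refine sum_congr rfl fun j _ => ?_
      rw [mul_sum]
      exact sum_congr rfl fun i _ => by ring
    rw [e1]
    calc _ ≤ (∑ j ∈ J, ‖∑ i ∈ I, a i * h (p i - q j)‖) ^ 2 := by
          refine pow_le_pow_left₀ (norm_nonneg _) ((norm_sum_le _ _).trans ?_) 2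
          refine sum_le_sum fun j _ => ?_
          rw [norm_mul]
          exact mul_le_of_le_one_left (norm_nonneg _) (hb j)
      _ ≤ #J * ∑ j ∈ J, ‖∑ i ∈ I, a i * h (p i - q j)‖ ^ 2 := sq_sum_le_card_mul_sum_sq
      _ ≤ #J * V := by
          gcongr
          rw [← sum_image (f := fun y => ‖∑ i ∈ I, a i * h (p i - y)‖ ^ 2) hq]
          exact sum_le_sum_of_subset_of_nonneg (subset_univ _) fun _ _ _ => by positivity
  have h2 : V ^ 2 ≤ (#I : ℝ) ^ 3 * ∑ r, ‖autocorr h r‖ ^ 2 := by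
    have e2 : V ≤ ∑ x ∈ I ×ˢ I, ‖autocorr h (p x.2 - p x.1)‖ := by
      have : ‖(V : ℂ)‖ = V := by rw [Complex.norm_real, Real.norm_of_nonneg hV0]
      rw [← this, hV, sum_norm_sq_conv_eq, ← sum_product']
      refine (norm_sum_le _ _).trans (sum_le_sum fun x _ => ?_)
      rw [norm_mul, norm_mul, RCLike.norm_conj]
      exact mul_le_of_le_one_left (norm_nonneg _)
        (mul_le_one₀ (ha _) (norm_nonneg _) (ha _))
    calc V ^ 2 ≤ (∑ x ∈ I ×ˢ I, ‖autocorr h (p x.2 - p x.1)‖) ^ 2 := pow_le_pow_left₀ hV0 e2 2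
      _ ≤ #(I ×ˢ I) * ∑ x ∈ I ×ˢ I, ‖autocorr h (p x.2 - p x.1)‖ ^ 2 :=
          sq_sum_le_card_mul_sum_sq
      _ ≤ (#I : ℝ) ^ 2 * (#I * ∑ r, ‖autocorr h r‖ ^ 2) := by
          rw [card_product]
          push_cast
          rw [← sq]
          gcongr
          rw [sum_product, ← nsmul_eq_mul]
          refine sum_le_card_nsmul _ _ _ fun i _ => ?_
          rw [← sum_image (g := fun j => p j - p i)
            (f := fun r => ‖autocorr h r‖ ^ 2) fun x hx y hy hxy =>
              hp hx hy (sub_left_injective hxy)]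
          exact sum_le_sum_of_subset_of_nonneg (subset_univ _) fun _ _ _ => by positivity
      _ = _ := by ring
  calc ‖∑ i ∈ I, ∑ j ∈ J, a i * b j * h (p i - q j)‖ ^ 4
      = (‖∑ i ∈ I, ∑ j ∈ J, a i * b j * h (p i - q j)‖ ^ 2) ^ 2 := by ring
    _ ≤ (#J * V) ^ 2 := pow_le_pow_left₀ (by positivity) h1 2
    _ = (#J : ℝ) ^ 2 * V ^ 2 := by ring
    _ ≤ _ := by
        rw [gowersU2_pow_four_mul, mul_assoc]
        gcongr

lemma gowersU2Interval_nonneg (f : ℕ → ℂ) (x L : ℕ) : 0 ≤ gowersU2Interval f x L :=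
  div_nonneg (gowersU2_nonneg _) (gowersU2_nonneg _)

lemma gowersU2_truncate_le (f : ℕ → ℂ) (x : ℕ) {L : ℕ} (hL : 0 < L) :
    gowersU2 (truncate f x L (4 * L + 1)) ≤ gowersU2Interval f x L := by
  have hpos : 0 < gowersU2 (truncate (fun _ => 1) 0 L (4 * L + 1)) := by
    refine gowersU2_pos (1 : ZMod (4 * L + 1)) ?_
    have : Fact (1 < 4 * L + 1) := ⟨by omega⟩
    have h1 : (1 : ZMod (4 * L + 1)).val = 1 := ZMod.val_one _
    simp only [truncate, h1]
    rw [if_pos ⟨le_rfl, hL⟩]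
    exact one_ne_zero
  have hle : gowersU2 (truncate (fun _ => 1) 0 L (4 * L + 1)) ≤ 1 := by
    refine gowersU2_le_one fun y => ?_
    unfold truncate
    split_ifs <;> simp
  rw [gowersU2Interval, le_div_iff₀ hpos]
  exact mul_le_of_le_one_right (gowersU2_nonneg _) hle

lemma norm_sum_box_le (f : ℕ → ℂ) (x : ℕ) {K L : ℕ} (hL : 0 < L) (hK : 2 * K ≤ L + 1)
    (a b : ℕ → ℂ) (ha : ∀ i, ‖a i‖ ≤ 1) (hb : ∀ j, ‖b j‖ ≤ 1) :
    ‖∑ i ∈ range K, ∑ j ∈ range K, a i * b j * f (x + (K + i - j))‖ ≤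
      K * (4 * L + 1) * gowersU2Interval f x L := by
  set M := 4 * L + 1 with hM
  have hinj : ∀ c : ℕ, Set.InjOn (fun i : ℕ => ((c + i : ℕ) : ZMod M)) (range K) := by
    intro c i hi j hj hij
    simp only [coe_range, Set.mem_Iio] at hi hj
    have hij : c + i ≡ c + j [MOD M] := (ZMod.natCast_eq_natCast_iff _ _ _).1 hij
    exact (Nat.ModEq.add_left_cancel' c hij).eq_of_lt_of_lt (by omega) (by omega)
  have key := norm_sum_box_pow_four_le (range K) (range K) a b ha hb
    (fun i => ((K + i : ℕ) : ZMod M)) (fun j => ((0 + j : ℕ) : ZMod M)) (hinj K) (hinj 0)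
    (truncate f x L M)
  have e1 : ∑ i ∈ range K, ∑ j ∈ range K, a i * b j * f (x + (K + i - j)) =
      ∑ i ∈ range K, ∑ j ∈ range K, a i * b j *
        truncate f x L M (((K + i : ℕ) : ZMod M) - ((0 + j : ℕ) : ZMod M)) := by
    refine sum_congr rfl fun i hi => sum_congr rfl fun j hj => ?_
    rw [mem_range] at hi hj
    congr 1
    rw [zero_add, ← Nat.cast_sub (by omega)]
    have : ((K + i - j : ℕ) : ZMod M).val = K + i - j := ZMod.val_cast_of_lt (by omega)
    simp only [truncate, this]
    rw [if_pos (by omega)]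
  rw [e1]
  rw [card_range, ZMod.card] at key
  have hMR : ((4 * (L : ℝ) + 1)) = (M : ℝ) := by rw [hM]; push_cast; ring
  rw [hMR]
  have hKM : (K : ℝ) ≤ M := by exact_mod_cast (by omega : K ≤ M)
  have hg := gowersU2_nonneg (truncate f x L M)
  have h2 : ‖∑ i ∈ range K, ∑ j ∈ range K, a i * b j *
      truncate f x L M (((K + i : ℕ) : ZMod M) - ((0 + j : ℕ) : ZMod M))‖ ≤
      K * M * gowersU2 (truncate f x L M) := by
    refine le_of_pow_le_pow_left₀ (n := 4) (by norm_num) (by positivity) (key.trans ?_)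
    calc _ = ((K : ℝ) ^ 4 * (M : ℝ) ^ 3 * gowersU2 (truncate f x L M) ^ 4) * K := by ring
      _ ≤ ((K : ℝ) ^ 4 * (M : ℝ) ^ 3 * gowersU2 (truncate f x L M) ^ 4) * M := by gcongr
      _ = _ := by ring
  refine h2.trans ?_
  gcongr
  exact gowersU2_truncate_le f x hL

/-- Averaging over translates of a short interval. -/
lemma nsmul_sum_eq_sum_sum_shift {R : Type*} [AddCommMonoid R] (g : ℕ → R) (K W : ℕ)
    (h0 : ∀ y < K, g y = 0) (h1 : ∀ y, W ≤ y → g y = 0) :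
    K • ∑ y ∈ range W, g y = ∑ y ∈ range W, ∑ i ∈ range K, g (y + i) := by
  rw [Finset.sum_comm, ← card_range K, ← sum_const, card_range]
  refine sum_congr rfl fun i hi => ?_
  rw [mem_range] at hi
  have e1 : ∑ y ∈ range W, g (y + i) = ∑ y ∈ Ico i (W + i), g y := by
    rw [sum_Ico_eq_sum_range]
    simp only [Nat.add_sub_cancel]
    exact sum_congr rfl fun y _ => by rw [add_comm]
  rw [e1]
  have e2 : ∑ y ∈ range (W + i), g y = ∑ y ∈ range W, g y := by
    rw [sum_range_add]
    simp [h1]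
  rw [← e2, ← sum_range_add_sum_Ico g (show i ≤ W + i by omega),
    sum_eq_zero fun y hy => h0 y (by rw [mem_range] at hy; omega), zero_add]

/-- The correlation of `f` with a difference of two sets is controlled by `U²` seminorms over
short intervals. -/
lemma norm_sum_sub_le (f : ℕ → ℂ) (m P : ℕ) {K L : ℕ} (hL : 0 < L) (hK0 : 0 < K)
    (hK : 2 * K ≤ L + 1) (hLK : L ≤ 2 * K) (hm : P + 2 * K ≤ m) (Z B : Finset ℕ)
    (hZ : Z ⊆ range P) (hB : B ⊆ range P) :
    ‖∑ z ∈ Z, ∑ b ∈ B, f (m + z - b)‖ ≤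
      9 * (P + K) * ∑ x ∈ Ico (m - (P + 2 * K)) (m + (P + 2 * K)), gowersU2Interval f x L := by
  classical
  set W := K + P with hW
  set a : ℕ → ℂ := fun y => if K ≤ y ∧ y - K ∈ Z then 1 else 0 with ha
  set b : ℕ → ℂ := fun y => if K ≤ y ∧ y - K ∈ B then 1 else 0 with hb
  have hnorm : ∀ S : Finset ℕ, ∀ y : ℕ,
      ‖(if K ≤ y ∧ y - K ∈ S then 1 else 0 : ℂ)‖ ≤ 1 := fun S y => by split_ifs <;> simp
  have hlow : ∀ S : Finset ℕ, ∀ y < K, (if K ≤ y ∧ y - K ∈ S then 1 else 0 : ℂ) = 0 :=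
    fun S y hy => if_neg (by omega)
  have hhigh : ∀ S : Finset ℕ, S ⊆ range P → ∀ y, W ≤ y →
      (if K ≤ y ∧ y - K ∈ S then 1 else 0 : ℂ) = 0 := fun S hS y hy => if_neg fun h => by
    have := mem_range.1 (hS h.2); omega
  have hsum : ∀ S : Finset ℕ, S ⊆ range P → ∀ g : ℕ → ℂ,
      ∑ y ∈ range W, (if K ≤ y ∧ y - K ∈ S then 1 else 0 : ℂ) * g y = ∑ z ∈ S, g (K + z) := by
    intro S hS g
    rw [hW, sum_range_add, sum_eq_zero fun y hy => by
      rw [hlow S y (mem_range.1 hy), zero_mul], zero_add]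
    simp only [Nat.add_sub_cancel_left, le_add_iff_nonneg_right, zero_le, true_and]
    simp only [ite_mul, one_mul, zero_mul]
    rw [sum_ite_mem, inter_eq_right.2 hS]
  have e0 : ∑ z ∈ Z, ∑ w ∈ B, f (m + z - w) =
      ∑ y ∈ range W, ∑ w ∈ range W, a y * b w * f (m + y - w) := by
    have : ∀ y, ∑ w ∈ range W, a y * b w * f (m + y - w) =
        a y * ∑ w ∈ B, f (m + y - (K + w)) := fun y => by
      rw [← hsum B hB fun w => f (m + y - w), mul_sum]
      exact sum_congr rfl fun w _ => by ring
    simp_rw [this]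
    rw [hsum Z hZ fun y => ∑ w ∈ B, f (m + y - (K + w))]
    refine sum_congr rfl fun z _ => sum_congr rfl fun w _ => ?_
    congr 1; omega
  have e1 : K • K • ∑ z ∈ Z, ∑ w ∈ B, f (m + z - w) =
      ∑ y ∈ range W, ∑ w ∈ range W, ∑ i ∈ range K, ∑ j ∈ range K,
        a (y + i) * b (w + j) * f (m + (y + i) - (w + j)) := by
    rw [e0, nsmul_sum_eq_sum_sum_shift (fun y => ∑ w ∈ range W, a y * b w * f (m + y - w)) K W
      (fun y hy => by simp only [ha]; simp [hlow Z y hy])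
      (fun y hy => by simp only [ha]; simp [hhigh Z hZ y hy]), smul_sum]
    refine sum_congr rfl fun y _ => ?_
    rw [smul_sum]
    have : ∀ i, K • ∑ w ∈ range W, a (y + i) * b w * f (m + (y + i) - w) =
        ∑ w ∈ range W, ∑ j ∈ range K, a (y + i) * b (w + j) * f (m + (y + i) - (w + j)) :=
      fun i => nsmul_sum_eq_sum_sum_shift (fun w => a (y + i) * b w * f (m + (y + i) - w)) K W
        (fun w hw => by simp only [hb]; simp [hlow B w hw])
        (fun w hw => by simp only [hb]; simp [hhigh B hB w hw])
    simp_rw [this]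
    rw [Finset.sum_comm]
  set U := ∑ x ∈ Ico (m - (P + 2 * K)) (m + (P + 2 * K)), gowersU2Interval f x L with hU
  have hU0 : 0 ≤ U := sum_nonneg fun _ _ => gowersU2Interval_nonneg _ _ _
  have hbox : ∀ y ∈ range W, ∀ w ∈ range W,
      ‖∑ i ∈ range K, ∑ j ∈ range K, a (y + i) * b (w + j) * f (m + (y + i) - (w + j))‖ ≤
        K * (4 * L + 1) * gowersU2Interval f (m + y - w - K) L := by
    intro y hy w hw
    rw [mem_range] at hy hw
    refine le_of_eq_of_le ?_ (norm_sum_box_le f (m + y - w - K) hL hK (fun i => a (y + i))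
      (fun j => b (w + j)) (fun i => hnorm Z _) fun j => hnorm B _)
    congr 1
    refine sum_congr rfl fun i hi => sum_congr rfl fun j hj => ?_
    rw [mem_range] at hi hj
    congr 2
    omega
  have hrow : ∀ w ∈ range W, ∑ y ∈ range W, gowersU2Interval f (m + y - w - K) L ≤ U := by
    intro w hw
    rw [mem_range] at hw
    rw [hU, ← sum_image (g := fun y => m + y - w - K)
      (f := fun x => gowersU2Interval f x L) (s := range W) fun x hx y hy hxy => by
        simp only at hxy; omega]
    refine sum_le_sum_of_subset_of_nonneg (fun x hx => ?_)
      fun _ _ _ => gowersU2Interval_nonneg _ _ _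
    obtain ⟨y, hy, rfl⟩ := mem_image.1 hx
    rw [mem_range] at hy
    rw [mem_Ico]
    omega
  have h2 : (K : ℝ) * (K * ‖∑ z ∈ Z, ∑ w ∈ B, f (m + z - w)‖) ≤ K * (4 * L + 1) * (W * U) := by
    have h3 := congrArg norm e1
    rw [nsmul_eq_mul, nsmul_eq_mul, norm_mul, norm_mul, Complex.norm_natCast] at h3
    rw [h3]
    refine (norm_sum_le _ _).trans ?_
    calc _ ≤ ∑ y ∈ range W, ∑ w ∈ range W,
          K * (4 * L + 1) * gowersU2Interval f (m + y - w - K) L :=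
          sum_le_sum fun y hy => (norm_sum_le _ _).trans (sum_le_sum fun w hw => hbox y hy w hw)
      _ = K * (4 * L + 1) * ∑ w ∈ range W, ∑ y ∈ range W,
          gowersU2Interval f (m + y - w - K) L := by
          rw [Finset.sum_comm]; simp_rw [mul_sum]
      _ ≤ K * (4 * L + 1) * (W * U) := by
          gcongr
          refine (sum_le_card_nsmul _ _ U hrow).trans ?_
          rw [card_range, nsmul_eq_mul]
  have hKR : (0 : ℝ) < K := by exact_mod_cast hK0
  have h5 : K * ‖∑ z ∈ Z, ∑ w ∈ B, f (m + z - w)‖ ≤ K * (9 * (P + K) * U) := by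
    have h6 : K * ‖∑ z ∈ Z, ∑ w ∈ B, f (m + z - w)‖ ≤ (4 * L + 1) * (W * U) := by
      refine le_of_mul_le_mul_left (h2.trans_eq ?_) hKR
      ring
    refine h6.trans ?_
    have h7 : (4 * (L : ℝ) + 1) ≤ 9 * K := by exact_mod_cast (by omega : 4 * L + 1 ≤ 9 * K)
    have h8 : (W : ℝ) = K + P := by rw [hW]; push_cast; ring
    calc _ ≤ 9 * K * (W * U) := by gcongr
      _ = _ := by rw [h8]; ring
  exact le_of_mul_le_mul_left h5 hKR

end Gowers

section Kronecker

open Finset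

lemma e_add (x y : ℝ) : e (x + y) = e x * e y := by
  simp only [e, ← Complex.exp_add]
  push_cast
  ring_nf

lemma e_zero : e 0 = 1 := by simp [e]

lemma e_intCast (n : ℤ) : e n = 1 := by
  have := Complex.exp_int_mul_two_pi_mul_I n
  rw [e, ← this]
  push_cast
  ring_nf

lemma e_eq_exp (x : ℝ) : e x = Complex.exp ((2 * Real.pi * x : ℝ) * Complex.I) := by
  rw [e]
  push_cast
  ring_nf

lemma norm_e (x : ℝ) : ‖e x‖ = 1 := by
  rw [e_eq_exp, Complex.norm_exp_ofReal_mul_I]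

lemma re_e (x : ℝ) : (e x).re = Real.cos (2 * Real.pi * x) := by
  rw [e_eq_exp, Complex.exp_ofReal_mul_I_re]

lemma im_e (x : ℝ) : (e x).im = Real.sin (2 * Real.pi * x) := by
  rw [e_eq_exp, Complex.exp_ofReal_mul_I_im]

lemma e_nat_mul (n : ℕ) (x : ℝ) : e (n * x) = e x ^ n := by
  induction n with
  | zero => simp [e_zero]
  | succ n ih => rw [pow_succ, ← ih, ← e_add]; push_cast; ring_nf

lemma e_sum {ι : Type*} (s : Finset ι) (f : ι → ℝ) : e (∑ i ∈ s, f i) = ∏ i ∈ s, e (f i) := by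
  classical
  induction s using Finset.induction_on with
  | empty => simp [e_zero]
  | insert a s ha ih => rw [sum_insert ha, prod_insert ha, e_add, ih]

lemma e_sub_round (x : ℝ) : e (x - round x) = e x := by
  have h := e_add (x - round x) (round x)
  rw [sub_add_cancel, e_intCast, mul_one] at h
  exact h.symm

lemma norm_one_add_e_sq (x : ℝ) : ‖1 + e x‖ ^ 2 = 2 + 2 * Real.cos (2 * Real.pi * x) := by
  rw [← Complex.normSq_eq_norm_sq, Complex.normSq_apply]
  simp only [Complex.add_re, Complex.one_re, Complex.add_im, Complex.one_im, re_e, im_e]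
  nlinarith [Real.sin_sq_add_cos_sq (2 * Real.pi * x)]

lemma norm_e_sub_one_sq (x : ℝ) : ‖e x - 1‖ ^ 2 = 2 - 2 * Real.cos (2 * Real.pi * x) := by
  rw [← Complex.normSq_eq_norm_sq, Complex.normSq_apply]
  simp only [Complex.sub_re, Complex.one_re, Complex.sub_im, Complex.one_im, re_e, im_e]
  nlinarith [Real.sin_sq_add_cos_sq (2 * Real.pi * x)]

lemma norm_e_sub_one_sq_eq_sin (x : ℝ) : ‖e x - 1‖ ^ 2 = 4 * Real.sin (Real.pi * x) ^ 2 := by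
  rw [norm_e_sub_one_sq, show 2 * Real.pi * x = 2 * (Real.pi * x) by ring, Real.cos_two_mul]
  nlinarith [Real.sin_sq_add_cos_sq (Real.pi * x)]

lemma abs_sub_round_eq (x : ℝ) : |x - round x| = ‖(x : UnitAddCircle)‖ :=
  (UnitAddCircle.norm_eq).symm

lemma norm_e_sub_one_le (x : ℝ) : ‖e x - 1‖ ≤ 2 * Real.pi * ‖(x : UnitAddCircle)‖ := by
  rw [← e_sub_round, ← abs_sub_round_eq]
  set y := x - round x
  refine le_of_pow_le_pow_left₀ (n := 2) (by norm_num) (by positivity) ?_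
  rw [norm_e_sub_one_sq_eq_sin, mul_pow, sq_abs]
  have h := Real.abs_sin_le_abs (x := Real.pi * y)
  have := sq_le_sq.2 h
  nlinarith

lemma four_mul_norm_le (x : ℝ) : 4 * ‖(x : UnitAddCircle)‖ ≤ ‖e x - 1‖ := by
  rw [← e_sub_round, ← abs_sub_round_eq]
  set y := x - round x with hy
  have hy2 : |y| ≤ 1 / 2 := abs_sub_round x
  refine le_of_pow_le_pow_left₀ (n := 2) (by norm_num) (by positivity) ?_
  rw [norm_e_sub_one_sq_eq_sin, mul_pow, sq_abs]
  have h := Real.mul_le_sin (x := Real.pi * |y|) (by positivity)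
    (by nlinarith [Real.pi_pos])
  have h2 : 2 / Real.pi * (Real.pi * |y|) = 2 * |y| := by
    field_simp
  rw [h2] at h
  have h3 : Real.sin (Real.pi * |y|) ^ 2 = Real.sin (Real.pi * y) ^ 2 := by
    rcases abs_choice y with h | h <;> rw [h]
    rw [mul_neg, Real.sin_neg, neg_sq]
  have h4 := pow_le_pow_left₀ (by positivity) h 2
  rw [h3, mul_pow, sq_abs] at h4
  linarith

lemma norm_one_add_e_div_two_sq_le {x δ : ℝ} (hδ : 0 ≤ δ) (h : δ ≤ ‖(x : UnitAddCircle)‖) :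
    ‖(1 + e x) / 2‖ ^ 2 ≤ 1 - 4 * δ ^ 2 := by
  have h1 := four_mul_norm_le x
  have h2 := pow_le_pow_left₀ (by positivity) ((mul_le_mul_of_nonneg_left h (by norm_num)).trans h1)
    2
  rw [norm_e_sub_one_sq] at h2
  rw [norm_div, div_pow, norm_one_add_e_sq]
  norm_num
  linarith

lemma norm_one_add_e_div_two_le (x : ℝ) : ‖(1 + e x) / 2‖ ≤ 1 := by
  rw [norm_div]
  have := norm_add_le 1 (e x)
  rw [norm_e] at this
  norm_num at this ⊢
  linarith

/-- The kernel `cos(πx)^(2k)`. -/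
def cosKernel (k : ℕ) (x : ℝ) : ℂ := e (-(k * x)) * ((1 + e x) / 2) ^ (2 * k)

/-- The Fourier coefficients of `cosKernel`. -/
def cosCoeff (k j : ℕ) : ℝ := (2 * k).choose j / 4 ^ k

lemma cosCoeff_nonneg (k j : ℕ) : 0 ≤ cosCoeff k j := by unfold cosCoeff; positivity

lemma sum_cosCoeff (k : ℕ) : ∑ j ∈ range (2 * k + 1), cosCoeff k j = 1 := by
  simp only [cosCoeff]
  rw [← sum_div, div_eq_one_iff_eq (by positivity)]
  have := Nat.sum_range_choose (2 * k)
  rw [pow_mul] at this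
  exact_mod_cast this

lemma cosKernel_eq (k : ℕ) (x : ℝ) :
    cosKernel k x = ∑ j ∈ range (2 * k + 1), (cosCoeff k j : ℂ) * e (((j : ℝ) - k) * x) := by
  rw [cosKernel, div_pow, add_comm 1 (e x), add_pow, pow_mul, sum_div, mul_sum]
  refine sum_congr rfl fun j _ => ?_
  rw [sub_mul, sub_eq_add_neg, e_add, e_nat_mul, cosCoeff]
  push_cast
  norm_num
  ring

lemma norm_cosKernel_le (k : ℕ) (x : ℝ) : ‖cosKernel k x‖ ≤ 1 := by
  rw [cosKernel, norm_mul, norm_e, one_mul, norm_pow]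
  exact pow_le_one₀ (norm_nonneg _) (norm_one_add_e_div_two_le x)

lemma norm_cosKernel_le_of_le (k : ℕ) {x δ : ℝ} (hδ : 0 ≤ δ) (h : δ ≤ ‖(x : UnitAddCircle)‖) :
    ‖cosKernel k x‖ ≤ (1 - 4 * δ ^ 2) ^ k := by
  rw [cosKernel, norm_mul, norm_e, one_mul, norm_pow, pow_mul]
  exact pow_le_pow_left₀ (by positivity) (norm_one_add_e_div_two_sq_le hδ h) k

lemma prod_cosKernel_eq {d : ℕ} (k : ℕ) (x : Fin d → ℝ) :
    ∏ i, cosKernel k (x i) = ∑ p ∈ Fintype.piFinset fun _ : Fin d => range (2 * k + 1),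
      ((∏ i, cosCoeff k (p i) : ℝ) : ℂ) * e (∑ i, ((p i : ℝ) - k) * x i) := by
  simp_rw [cosKernel_eq]
  rw [prod_univ_sum]
  refine sum_congr rfl fun p _ => ?_
  rw [prod_mul_distrib, e_sum]
  push_cast
  rfl

lemma norm_sum_e_le (r₀ R : ℕ) (θ : ℝ) :
    ‖∑ r ∈ Ico r₀ (r₀ + R), e (r * θ)‖ * (2 * ‖(θ : UnitAddCircle)‖) ≤ 1 := by
  have h1 : (∑ r ∈ Ico r₀ (r₀ + R), e (r * θ)) * (e θ - 1) = e θ ^ (r₀ + R) - e θ ^ r₀ := by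
    simp_rw [e_nat_mul]
    exact geom_sum_Ico_mul _ (by omega)
  have h2 : ‖e θ ^ (r₀ + R) - e θ ^ r₀‖ ≤ 2 := by
    refine (norm_sub_le _ _).trans ?_
    rw [norm_pow, norm_pow, norm_e]
    norm_num
  rw [← h1, norm_mul] at h2
  nlinarith [four_mul_norm_le θ, norm_nonneg (∑ r ∈ Ico r₀ (r₀ + R), e (r * θ))]

lemma re_e_nonneg {r : ℕ} {θ : ℝ} (h : r * ‖(θ : UnitAddCircle)‖ ≤ 1 / 4) :
    0 ≤ (e (r * θ)).re := by
  have : e (r * θ) = e (r * (θ - round θ)) := by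
    rw [e_nat_mul, e_nat_mul, e_sub_round]
  rw [this, re_e]
  rw [← abs_sub_round_eq] at h
  have h2 : |(r : ℝ) * (θ - round θ)| ≤ 1 / 4 := by rwa [abs_mul, Nat.abs_cast]
  rw [abs_le] at h2
  apply Real.cos_nonneg_of_mem_Icc
  constructor <;> nlinarith [Real.pi_pos]

/-- If the bounded integer combinations of the frequencies `α` either are very close to integers or
far from them at scale `H`, then the orbit of `0` under the rotation by `α` returns to a
neighbourhood of `0` at some time close to `H`, and this time may be taken to be divisible by a
given number. -/
theorem exists_return_time (d : ℕ) {K : ℕ} (hK : 0 < K) {δ : ℝ} (hδ : 0 < δ) (hδ' : δ ≤ 1 / 4) :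
    ∃ C : ℝ, 1 ≤ C ∧ ∃ H₀ : ℕ, ∀ H ≥ H₀, ∀ α : Fin d → ℝ,
      (∀ w : Fin d → ℤ, (∀ i, |(w i : ℝ)| ≤ C) →
        ‖((∑ i, (w i : ℝ) * α i : ℝ) : UnitAddCircle)‖ ≤ 1 / (C * H) ∨
        C / H ≤ ‖((∑ i, (w i : ℝ) * α i : ℝ) : UnitAddCircle)‖) →
      ∃ Q : ℕ, K ∣ Q ∧ H ≤ Q ∧ (Q : ℝ) ≤ (1 + δ) * H ∧
        ∀ i, ‖((Q * α i : ℝ) : UnitAddCircle)‖ ≤ δ := by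
  obtain ⟨k, hk0, hk⟩ : ∃ k : ℕ, 0 < k ∧
      (1 - 4 * δ ^ 2) ^ k < cosCoeff k k ^ d / 2 := by
    have h1 : |1 - 4 * δ ^ 2| < 1 := by rw [abs_lt]; constructor <;> nlinarith
    have h2 := tendsto_pow_const_mul_const_pow_of_abs_lt_one d h1
    have h3 : (0 : ℝ) < 1 / (2 * 2 ^ d) := by positivity
    obtain ⟨k, hk, hk0⟩ := ((h2.eventually_lt_const h3).and (eventually_gt_atTop 0)).exists
    refine ⟨k, hk0, ?_⟩
    have hkR : (0 : ℝ) < k := by exact_mod_cast hk0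
    have h4 : 1 / (2 * (k : ℝ)) ≤ cosCoeff k k := by
      have := Nat.four_pow_le_two_mul_self_mul_centralBinom k hk0
      rw [cosCoeff, div_le_div_iff₀ (by positivity) (by positivity), one_mul]
      rw [Nat.centralBinom] at this
      have h5 : ((4 ^ k : ℕ) : ℝ) ≤ ((2 * k * (2 * k).choose k : ℕ) : ℝ) := by exact_mod_cast this
      push_cast at h5
      linarith
    have h5 := pow_le_pow_left₀ (by positivity) h4 d
    refine lt_of_lt_of_le ?_ (div_le_div_of_nonneg_right h5 (by norm_num))
    rw [div_pow, one_pow, mul_pow, div_div, lt_div_iff₀ (by positivity)]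
    rw [lt_div_iff₀ (by positivity)] at hk
    linarith
  set ck := cosCoeff k k ^ d with hck
  have hck0 : 0 < ck := by
    have : 0 ≤ (1 - 4 * δ ^ 2) ^ k := pow_nonneg (by nlinarith) k
    linarith
  have hKR : (0 : ℝ) < K := by exact_mod_cast hK
  set C : ℝ := max 8 (max (K * k) (4 * K / (ck * δ))) with hC
  have hC8 : 8 ≤ C := le_max_left _ _
  have hCk : K * k ≤ C := (le_max_left _ _).trans (le_max_right _ _)
  have hCη : 4 * K / (ck * δ) ≤ C := (le_max_right _ _).trans (le_max_right _ _)
  refine ⟨C, by linarith, ⌈4 * K / δ⌉₊ + 1, fun H hH α hα => ?_⟩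
  have hH1 : 4 * K / δ ≤ H := (Nat.le_ceil _).trans (Nat.cast_le.2 (by omega))
  have hH0 : (0 : ℝ) < H := by exact_mod_cast (by omega)
  have hKH : 4 * K ≤ δ * H := by rwa [div_le_iff₀ hδ, mul_comm (H : ℝ)] at hH1
  set r₀ := H / K + 1 with hr₀
  set R := ⌊δ * H / (2 * K)⌋₊ with hR
  have hr₀l : H ≤ K * r₀ := by
    have := Nat.lt_mul_div_succ H hK
    rw [hr₀]; exact this.le
  have hr₀u : K * r₀ ≤ H + K := by
    rw [hr₀, mul_add, mul_one]
    have := Nat.mul_div_le H K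
    omega
  have hRu : (R : ℝ) * (2 * K) ≤ δ * H := by
    rw [← le_div_iff₀ (by positivity)]
    exact Nat.floor_le (by positivity)
  have hRl : δ * H ≤ R * (4 * K) := by
    have h1 : δ * H / (2 * K) < R + 1 := Nat.lt_floor_add_one _
    rw [div_lt_iff₀ (by positivity)] at h1
    nlinarith
  have hR0 : (0 : ℝ) < R := by
    by_contra! h
    nlinarith [mul_pos hδ hH0]
  have hbd : ∀ r ∈ Ico r₀ (r₀ + R), H ≤ K * r ∧ ((K * r : ℕ) : ℝ) ≤ (1 + δ) * H := by
    intro r hr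
    rw [mem_Ico] at hr
    refine ⟨hr₀l.trans (Nat.mul_le_mul_left K hr.1), ?_⟩
    have h1 : ((K * r₀ : ℕ) : ℝ) ≤ H + K := by exact_mod_cast hr₀u
    have h2 : (r : ℝ) ≤ r₀ + R := by exact_mod_cast hr.2.le
    push_cast at h1 ⊢
    nlinarith
  by_contra! hcon
  have hbig : ∀ r ∈ Ico r₀ (r₀ + R), ‖∏ i, cosKernel k (r * (K * α i))‖ ≤ (1 - 4 * δ ^ 2) ^ k := by
    intro r hr
    obtain ⟨h1, h2⟩ := hbd r hr
    obtain ⟨i, hi⟩ := hcon (K * r) ⟨r, rfl⟩ h1 h2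
    have e1 : ((K * r : ℕ) : ℝ) * α i = r * (K * α i) := by push_cast; ring
    rw [e1] at hi
    rw [norm_prod, ← mul_prod_erase _ _ (mem_univ i)]
    have h3 : ∏ j ∈ univ.erase i, ‖cosKernel k (r * (K * α j))‖ ≤ 1 :=
      prod_le_one (fun _ _ => norm_nonneg _) fun _ _ => norm_cosKernel_le _ _
    exact (mul_le_of_le_one_right (norm_nonneg _) h3).trans (norm_cosKernel_le_of_le k hδ.le hi.le)
  have hupper : (∑ r ∈ Ico r₀ (r₀ + R), ∏ i, cosKernel k (r * (K * α i))).re ≤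
      R * (1 - 4 * δ ^ 2) ^ k := by
    refine (Complex.re_le_norm _).trans ((norm_sum_le _ _).trans ?_)
    refine (sum_le_card_nsmul _ _ _ hbig).trans (le_of_eq ?_)
    rw [Nat.card_Ico, Nat.add_sub_cancel_left, nsmul_eq_mul]
  set θ : (Fin d → ℕ) → ℝ := fun p => ∑ i, ((p i : ℝ) - k) * (K * α i) with hθ
  have hterm : ∀ p ∈ Fintype.piFinset fun _ : Fin d => range (2 * k + 1),
      -(ck / 2 * R) ≤ (∑ r ∈ Ico r₀ (r₀ + R), e (r * θ p)).re := by
    intro p hp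
    rw [Fintype.mem_piFinset] at hp
    have hw := hα (fun i => K * ((p i : ℤ) - k)) fun i => by
      have h1 := mem_range.1 (hp i)
      push_cast
      rw [abs_mul, Nat.abs_cast]
      refine le_trans ?_ hCk
      gcongr
      rw [abs_le]
      have h2 : (p i : ℝ) ≤ 2 * k := by exact_mod_cast (by omega)
      constructor <;> linarith [(Nat.cast_nonneg (p i) : (0 : ℝ) ≤ p i)]
    have hθw : (∑ i, ((K * ((p i : ℤ) - k) : ℤ) : ℝ) * α i) = θ p := by
      rw [hθ]
      refine sum_congr rfl fun i _ => ?_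
      push_cast
      ring
    rw [hθw] at hw
    rcases hw with hw | hw
    · have : 0 ≤ (∑ r ∈ Ico r₀ (r₀ + R), e (r * θ p)).re := by
        rw [Complex.re_sum]
        refine sum_nonneg fun r hr => re_e_nonneg ?_
        have h1 := (hbd r hr).2
        have h2 : (r : ℝ) ≤ 2 * H := by
          push_cast at h1
          have : (1 : ℝ) ≤ K := by exact_mod_cast hK
          nlinarith [(Nat.cast_nonneg r : (0 : ℝ) ≤ r)]
        calc (r : ℝ) * ‖(θ p : UnitAddCircle)‖ ≤ 2 * H * (1 / (C * H)) := by gcongr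
          _ = 2 / C := by field_simp
          _ ≤ 1 / 4 := by rw [div_le_div_iff₀ (by linarith) (by norm_num)]; linarith
      have h0 : 0 ≤ ck / 2 * R := by positivity
      linarith
    · have h1 := norm_sum_e_le r₀ R (θ p)
      have h2 : ‖∑ r ∈ Ico r₀ (r₀ + R), e (r * θ p)‖ ≤ ck / 2 * R := by
        set S := ‖∑ r ∈ Ico r₀ (r₀ + R), e (r * θ p)‖ with hS
        have hS0 : 0 ≤ S := norm_nonneg _
        have h3 : S * (2 * (C / H)) ≤ 1 := le_trans (by gcongr) h1
        have h4 : S * (2 * C) ≤ H := by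
          rw [show S * (2 * (C / H)) = S * (2 * C) / H by ring, div_le_one hH0] at h3
          exact h3
        have h5 : 4 * K ≤ C * (ck * δ) := by rwa [div_le_iff₀ (by positivity)] at hCη
        have h6 : C * δ * (ck / 2 * R) * (4 * K) ≥ δ * (S * C) * (4 * K) := by
          have h7 : δ * (S * (2 * C)) ≤ R * (4 * K) := le_trans (by gcongr) hRl
          nlinarith
        have h8 : 0 < C * δ * (4 * K) := by positivity
        refine le_of_mul_le_mul_right ?_ h8
        linarith
      have h3 := Complex.abs_re_le_norm (∑ r ∈ Ico r₀ (r₀ + R), e (r * θ p))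
      exact (abs_le.1 (h3.trans h2)).1
  have hlower : ck / 2 * R ≤
      (∑ r ∈ Ico r₀ (r₀ + R), ∏ i, cosKernel k (r * (K * α i))).re := by
    have e1 : (∑ r ∈ Ico r₀ (r₀ + R), ∏ i, cosKernel k (r * (K * α i))) =
        ∑ p ∈ Fintype.piFinset fun _ : Fin d => range (2 * k + 1),
          ((∏ i, cosCoeff k (p i) : ℝ) : ℂ) * ∑ r ∈ Ico r₀ (r₀ + R), e (r * θ p) := by
      simp_rw [prod_cosKernel_eq, mul_sum]
      rw [Finset.sum_comm]
      refine sum_congr rfl fun p _ => sum_congr rfl fun r _ => ?_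
      congr 2
      rw [hθ, mul_sum]
      exact sum_congr rfl fun i _ => by ring
    have hsum : ∑ p ∈ Fintype.piFinset fun _ : Fin d => range (2 * k + 1),
        ∏ i, cosCoeff k (p i) = 1 := by
      rw [← prod_univ_sum]
      simp [sum_cosCoeff]
    rw [e1, Complex.re_sum]
    simp_rw [Complex.re_ofReal_mul]
    set p₀ : Fin d → ℕ := fun _ => k with hp₀
    have hp₀m : p₀ ∈ Fintype.piFinset fun _ : Fin d => range (2 * k + 1) := by
      rw [Fintype.mem_piFinset]
      intro i
      exact mem_range.2 (show k < 2 * k + 1 by omega)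
    have hp₀v : (∏ i, cosCoeff k (p₀ i)) * (∑ r ∈ Ico r₀ (r₀ + R), e (r * θ p₀)).re = ck * R := by
      have : θ p₀ = 0 := by simp [hθ, hp₀]
      rw [this]
      simp [e_zero, hp₀, hck]
    have hc0 : ∀ p : Fin d → ℕ, 0 ≤ ∏ i, cosCoeff k (p i) :=
      fun p => prod_nonneg fun _ _ => cosCoeff_nonneg _ _
    rw [← add_sum_erase _ _ hp₀m, hp₀v]
    rw [← add_sum_erase _ _ hp₀m] at hsum
    have h1 : (∑ p ∈ (Fintype.piFinset fun _ : Fin d => range (2 * k + 1)).erase p₀,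
        ∏ i, cosCoeff k (p i)) * (-(ck / 2 * R)) ≤
        ∑ p ∈ (Fintype.piFinset fun _ : Fin d => range (2 * k + 1)).erase p₀,
          (∏ i, cosCoeff k (p i)) * (∑ r ∈ Ico r₀ (r₀ + R), e (r * θ p)).re := by
      rw [sum_mul]
      exact sum_le_sum fun p hp =>
        mul_le_mul_of_nonneg_left (hterm p (mem_of_mem_erase hp)) (hc0 p)
    have h2 := hc0 p₀
    have h3 : 0 ≤ ck / 2 * R := by positivity
    nlinarith
  have := hlower.trans hupper
  nlinarith

end Kronecker

section Local

open Finset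

/-- `Q` is a period near `H`, divisible by all numbers up to `K`, for which the local sumset
property around `n` holds for all sets `B ⊆ [H]`; the subsets of `B` may be taken to contain
`B ∩ [K]`. -/
def IsGoodPeriod (A : Set ℕ) (H : ℕ) (ε : ℝ) (K n Q : ℕ) : Prop :=
  H ≤ Q ∧ (Q : ℝ) ≤ (1 + ε) * H ∧ (∀ m, 0 < m → m ≤ K → m ∣ Q) ∧
    ∀ B ⊆ Set.Icc 1 H, ∃ An Bn : Set ℕ, IsLocalSumsetPair A B n Q ε An Bn ∧
      B ∩ Set.Icc 1 K ⊆ Bn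

/-- If few pairs `(z, b)` with `z ∉ A + B - n` and `b ∈ B` have `z - b ∈ A - n` modulo `Q`, then the
removal lemma produces a local sumset pair. -/
lemma exists_isLocalSumsetPair {ε κ : ℝ}
    (hκ : ∀ (G : Type) [AddCommGroup G] [Fintype G] [DecidableEq G] (X Y Z : Finset G),
      (#{p ∈ X ×ˢ Y | p.1 + p.2 ∈ Z} : ℝ) ≤ κ * (Fintype.card G : ℝ) ^ 2 →
      ∃ X' ⊆ X, ∃ Y' ⊆ Y, ∃ Z' ⊆ Z,
        (#(X \ X') : ℝ) ≤ ε / 2 * Fintype.card G ∧ (#(Y \ Y') : ℝ) ≤ ε / 2 * Fintype.card G ∧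
        (#(Z \ Z') : ℝ) ≤ ε / 2 * Fintype.card G ∧ ∀ x ∈ X', ∀ y ∈ Y', x + y ∉ Z')
    (A B : Set ℕ) (n K : ℕ) {Q : ℕ} (hQ : 0 < Q) (hK : (K : ℝ) ≤ ε / 2 * Q)
    (hB : B ⊆ Set.Icc 1 Q) (T : Finset (ℕ × ℕ))
    (hT : ∀ z b, z < Q → n + z ∉ A + B → b ∈ B → n + Q + z - b ∈ A → (z, b) ∈ T)
    (hcard : (#T : ℝ) ≤ κ * (Q : ℝ) ^ 2) :
    ∃ An Bn : Set ℕ, IsLocalSumsetPair A B n Q ε An Bn ∧ B ∩ Set.Icc 1 K ⊆ Bn := by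
  classical
  have : NeZero Q := ⟨hQ.ne'⟩
  set X : Finset (ZMod Q) := {x | n + x.val ∈ A} with hX
  set Y : Finset (ZMod Q) := {y | ∃ b ∈ B, (b : ZMod Q) = y} with hY
  set Z : Finset (ZMod Q) := {z | n + z.val ∉ A + B} with hZ
  have hsub : ({p ∈ X ×ˢ Y | p.1 + p.2 ∈ Z} : Finset (ZMod Q × ZMod Q)) ⊆
      T.image fun p => ((p.1 : ZMod Q) - (p.2 : ZMod Q), (p.2 : ZMod Q)) := by
    rintro ⟨x, y⟩ h
    simp only [hX, hY, hZ, mem_filter, mem_product, mem_univ, true_and] at h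
    obtain ⟨⟨hx, b, hb, rfl⟩, hz⟩ := h
    refine mem_image.2 ⟨((x + (b : ZMod Q)).val, b), ?_, ?_⟩
    · refine hT _ _ (ZMod.val_lt _) hz hb ?_
      have hb' := hB hb
      rw [Set.mem_Icc] at hb'
      have hxQ := ZMod.val_lt x
      have hv : (x + (b : ZMod Q)).val = (x.val + b) % Q := by
        rw [ZMod.val_add, ZMod.val_natCast, Nat.add_mod_mod]
      rcases lt_or_ge (x.val + b) Q with h | h
      · rw [hv, Nat.mod_eq_of_lt h, ← add_assoc] at hz
        exact absurd (Set.add_mem_add hx hb) hz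
      · rw [hv, Nat.mod_eq_sub_mod h, Nat.mod_eq_of_lt (by omega)]
        rwa [show n + Q + (x.val + b - Q) - b = n + x.val by omega]
    · simp
  have hfew : (#{p ∈ X ×ˢ Y | p.1 + p.2 ∈ Z} : ℝ) ≤ κ * (Fintype.card (ZMod Q) : ℝ) ^ 2 := by
    rw [ZMod.card]
    refine le_trans ?_ hcard
    exact_mod_cast (card_le_card hsub).trans card_image_le
  obtain ⟨X', hX', Y', hY', Z', hZ', hXc, hYc, hZc, hfree⟩ := hκ (ZMod Q) X Y Z hfew
  rw [ZMod.card] at hXc hYc hZc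
  have hQR : (0 : ℝ) < Q := by exact_mod_cast hQ
  have hhalf : ε / 2 * Q ≤ ε * Q := by linarith [(Nat.cast_nonneg K : (0 : ℝ) ≤ K)]
  have hncard : ∀ (S : Set ℕ) (F : Finset (ZMod Q)) (g : ZMod Q → ℕ), S ⊆ F.image g →
      ((S.ncard : ℕ) : ℝ) ≤ #F := fun S F g h => by
    have h1 := Set.ncard_le_ncard h (Finset.finite_toSet _)
    rw [Set.ncard_coe_finset] at h1
    exact_mod_cast h1.trans card_image_le
  refine ⟨{x | x < Q ∧ (x : ZMod Q) ∈ X'}, {b | b ∈ B ∧ (b : ZMod Q) ∈ Y'} ∪ (B ∩ Set.Icc 1 K),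
    ⟨?_, ?_, ?_, ?_, ?_⟩, Set.subset_union_right⟩
  · rintro x ⟨hx, hx'⟩
    have := hX' hx'
    rw [hX, mem_filter, ZMod.val_cast_of_lt hx] at this
    exact ⟨hx, this.2⟩
  · exact Set.union_subset (fun b hb => hb.1) Set.inter_subset_left
  · refine ((hncard _ (X \ X') ZMod.val fun x hx => ?_).trans hXc).trans hhalf
    obtain ⟨⟨hxQ, hxA⟩, hx⟩ := hx
    rw [coe_image]
    refine ⟨(x : ZMod Q), ?_, ZMod.val_cast_of_lt hxQ⟩
    rw [mem_coe, Finset.mem_sdiff]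
    refine ⟨?_, fun h => hx ⟨hxQ, h⟩⟩
    rw [hX, mem_filter, ZMod.val_cast_of_lt hxQ]
    exact ⟨mem_univ _, hxA⟩
  · refine ((hncard _ (Y \ Y') (fun y => if y.val = 0 then Q else y.val)
      fun b hb => ?_).trans hYc).trans hhalf
    obtain ⟨hbB, hb⟩ := hb
    rw [coe_image]
    refine ⟨(b : ZMod Q), ?_, ?_⟩
    · rw [mem_coe, Finset.mem_sdiff]
      refine ⟨?_, fun h => hb (Or.inl ⟨hbB, h⟩)⟩
      rw [hY, mem_filter]
      exact ⟨mem_univ _, b, hbB, rfl⟩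
    · have h1 := hB hbB
      rw [Set.mem_Icc] at h1
      simp only [ZMod.val_natCast]
      rcases h1.2.lt_or_eq with h2 | h2
      · rw [Nat.mod_eq_of_lt h2, if_neg (by omega)]
      · rw [h2, Nat.mod_self, if_pos rfl]
  · have hincl : sumMod Q {x | x < Q ∧ (x : ZMod Q) ∈ X'}
        ({b | b ∈ B ∧ (b : ZMod Q) ∈ Y'} ∪ (B ∩ Set.Icc 1 K)) \ window (A + B) n Q ⊆
        ((Z \ Z').image ZMod.val : Finset ℕ) ∪ (range K : Set ℕ) := by
      rintro z ⟨⟨x, ⟨hxQ, hx⟩, y, hy, rfl⟩, hzw⟩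
      have hlt : (x + y) % Q < Q := Nat.mod_lt _ hQ
      have hzA : n + (x + y) % Q ∉ A + B := fun h => hzw ⟨hlt, h⟩
      rcases hy with ⟨hyB, hy⟩ | ⟨hyB, hyK⟩
      · left
        rw [coe_image]
        refine ⟨((x + y : ℕ) : ZMod Q), ?_, ZMod.val_natCast _ _⟩
        rw [mem_coe, Finset.mem_sdiff]
        refine ⟨?_, ?_⟩
        · rw [hZ, mem_filter, ZMod.val_natCast]
          exact ⟨mem_univ _, hzA⟩
        · rw [Nat.cast_add]
          exact hfree _ hx _ hy
      · right
        rw [Set.mem_Icc] at hyK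
        have hyQ := (hB hyB).2
        have hxA := hX' hx
        rw [hX, mem_filter, ZMod.val_cast_of_lt hxQ] at hxA
        rw [coe_range, Set.mem_Iio]
        rcases lt_or_ge (x + y) Q with h | h
        · rw [Nat.mod_eq_of_lt h, ← add_assoc] at hzA
          exact absurd (Set.add_mem_add hxA.2 hyB) hzA
        · rw [Nat.mod_eq_sub_mod h, Nat.mod_eq_of_lt (by omega)]
          omega
    have h1 := Set.ncard_le_ncard hincl ((Finset.finite_toSet _).union (Finset.finite_toSet _))
    have h2 := h1.trans (Set.ncard_union_le _ _)
    rw [Set.ncard_coe_finset, Set.ncard_coe_finset, card_range] at h2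
    have h3 : (((Z \ Z').image ZMod.val).card : ℝ) ≤ #(Z \ Z') := by exact_mod_cast card_image_le
    have h4 : ((sumMod Q {x | x < Q ∧ (x : ZMod Q) ∈ X'}
        ({b | b ∈ B ∧ (b : ZMod Q) ∈ Y'} ∪ (B ∩ Set.Icc 1 K)) \ window (A + B) n Q).ncard : ℝ) ≤
        ((Z \ Z').image ZMod.val).card + K := by exact_mod_cast h2
    linarith

/-- If the indicator function of `A` is, around `n`, the sum of an almost `Q`-periodic function and
a `U²` uniform function, then few pairs `(z, b)` with `z ∉ A + B - n` and `b ∈ B` have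
`z - b ∈ A - n` modulo `Q`. -/
lemma card_bad_pairs_le {A : Set ℕ} {fstr funf : ℕ → ℝ}
    (hdec : ∀ n, A.indicator (fun _ => (1 : ℝ)) n = fstr n + funf n) {g : ℕ → ℂ} {σ η τ : ℝ}
    {H L Q n : ℕ} (hL : 0 < L) (hLH : L ≤ H) (hHQ : H ≤ Q) (hQH : Q ≤ 2 * H) (hn : 8 * H ≤ n)
    (hstr : ∑ y ∈ Ico (n - 8 * H) (n + 8 * H), ‖g y - fstr y‖ ≤ σ * H)
    (hper : ∀ y ∈ Ico (n - 2 * H) (n + 2 * H), ‖g (y + Q) - g y‖ ≤ η)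
    (hunf : ∑ x ∈ Ico (n - 8 * H) (n + 8 * H), gowersU2Interval (fun n => (funf n : ℂ)) x L ≤
      τ * H)
    (Z B : Finset ℕ) (hZ : Z ⊆ range Q) (hB : B ⊆ Icc 1 H)
    (hZB : ∀ z ∈ Z, ∀ b ∈ B, n + z - b ∉ A) (S : Finset (ℕ × ℕ))
    (hS : ∀ p ∈ S, p.1 ∈ Z ∧ p.2 ∈ B ∧ n + Q + p.1 - p.2 ∈ A) :
    (#S : ℝ) ≤ (2 * σ + 4 * η + 72 * τ) * (H : ℝ) ^ 2 := by
  classical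
  have hHR : (0 : ℝ) ≤ H := Nat.cast_nonneg _
  set f := A.indicator (fun _ => (1 : ℝ)) with hf
  have hf0 : ∀ m, 0 ≤ f m := fun m => Set.indicator_nonneg (fun _ _ => zero_le_one) _
  have hcard : (#S : ℝ) ≤ ∑ z ∈ Z, ∑ b ∈ B, f (n + Q + z - b) := by
    rw [← sum_product']
    have h1 : (#S : ℝ) = ∑ p ∈ S, f (n + Q + p.1 - p.2) := by
      rw [sum_congr rfl fun p hp => show f (n + Q + p.1 - p.2) = 1 from
        Set.indicator_of_mem (hS p hp).2.2 _]
      simp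
    rw [h1]
    exact sum_le_sum_of_subset_of_nonneg
      (fun p hp => mem_product.2 ⟨(hS p hp).1, (hS p hp).2.1⟩) fun _ _ _ => hf0 _
  have hsplit : ∑ z ∈ Z, ∑ b ∈ B, f (n + Q + z - b) =
      ∑ b ∈ B, ∑ z ∈ Z, (fstr (n + z - b + Q) - fstr (n + z - b)) +
      ∑ z ∈ Z, ∑ b ∈ B, funf (n + Q + z - b) - ∑ z ∈ Z, ∑ b ∈ B, funf (n + z - b) := by
    rw [Finset.sum_comm (s := B), ← sum_add_distrib, ← sum_sub_distrib]
    refine sum_congr rfl fun z hz => ?_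
    rw [← sum_add_distrib, ← sum_sub_distrib]
    refine sum_congr rfl fun b hb => ?_
    have h0 : f (n + z - b) = 0 := Set.indicator_of_notMem (hZB z hz b hb) _
    have h1 := hdec (n + z - b)
    have h2 := hdec (n + Q + z - b)
    have h3 := mem_Icc.1 (hB hb)
    rw [show n + z - b + Q = n + Q + z - b by omega]
    linarith
  have hunf' : ∀ m, n ≤ m → m ≤ n + Q → |∑ z ∈ Z, ∑ b ∈ B, funf (m + z - b)| ≤
      36 * τ * (H : ℝ) ^ 2 := by
    intro m hm hm'
    have h1 := norm_sum_sub_le (fun n => (funf n : ℂ)) m (Q + 1) (K := (L + 1) / 2) (L := L) hL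
      (by omega) (by omega) (by omega) (by omega) Z B
      (hZ.trans (range_subset_range.2 (by omega)))
      (fun b hb => mem_range.2 (by have := mem_Icc.1 (hB hb); omega))
    have e1 : (∑ z ∈ Z, ∑ b ∈ B, ((funf (m + z - b) : ℝ) : ℂ)) =
        ((∑ z ∈ Z, ∑ b ∈ B, funf (m + z - b) : ℝ) : ℂ) := by push_cast; rfl
    rw [e1, Complex.norm_real, Real.norm_eq_abs] at h1
    refine h1.trans ?_
    have h2 : ∑ x ∈ Ico (m - (Q + 1 + 2 * ((L + 1) / 2))) (m + (Q + 1 + 2 * ((L + 1) / 2))),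
        gowersU2Interval (fun n => (funf n : ℂ)) x L ≤ τ * H :=
      (sum_le_sum_of_subset_of_nonneg (Ico_subset_Ico (by omega) (by omega))
        fun _ _ _ => gowersU2Interval_nonneg _ _ _).trans hunf
    have h3 : (((Q + 1 : ℕ) : ℝ) + ((L + 1) / 2 : ℕ)) ≤ 4 * H := by
      exact_mod_cast (by omega : (Q + 1) + (L + 1) / 2 ≤ 4 * H)
    have h4 := sum_nonneg fun x (_ : x ∈ Ico (m - (Q + 1 + 2 * ((L + 1) / 2)))
      (m + (Q + 1 + 2 * ((L + 1) / 2)))) =>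
        gowersU2Interval_nonneg (fun n => (funf n : ℂ)) x L
    calc _ ≤ 9 * (4 * (H : ℝ)) * (τ * H) := by gcongr
      _ = _ := by ring
  have hstr' : ∑ b ∈ B, ∑ z ∈ Z, (fstr (n + z - b + Q) - fstr (n + z - b)) ≤
      H * (2 * σ * H + 4 * η * H) := by
    have hone : ∑ y ∈ Ico (n - 2 * H) (n + 2 * H), |fstr (y + Q) - fstr y| ≤
        2 * σ * H + 4 * η * H := by
      have hpt : ∀ y ∈ Ico (n - 2 * H) (n + 2 * H), |fstr (y + Q) - fstr y| ≤
          ‖g (y + Q) - fstr (y + Q)‖ + ‖g y - fstr y‖ + η := by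
        intro y hy
        have h1 := hper y hy
        rw [← Real.norm_eq_abs, ← Complex.norm_real]
        have e1 : ((fstr (y + Q) - fstr y : ℝ) : ℂ) =
            -(g (y + Q) - fstr (y + Q)) + (g y - fstr y) + (g (y + Q) - g y) := by
          push_cast; ring
        rw [e1]
        refine (norm_add₃_le).trans ?_
        rw [norm_neg]
        gcongr
      refine (sum_le_sum hpt).trans ?_
      rw [sum_add_distrib, sum_add_distrib, sum_const, Nat.card_Ico, nsmul_eq_mul]
      have h1 : ∑ y ∈ Ico (n - 2 * H) (n + 2 * H), ‖g (y + Q) - fstr (y + Q)‖ ≤ σ * H := by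
        refine le_trans ?_ hstr
        rw [sum_Ico_add' (fun y => ‖g y - fstr y‖)]
        exact sum_le_sum_of_subset_of_nonneg (Ico_subset_Ico (by omega) (by omega))
          fun _ _ _ => norm_nonneg _
      have h2 : ∑ y ∈ Ico (n - 2 * H) (n + 2 * H), ‖g y - fstr y‖ ≤ σ * H :=
        (sum_le_sum_of_subset_of_nonneg (Ico_subset_Ico (by omega) (by omega))
          fun _ _ _ => norm_nonneg _).trans hstr
      have h3 : ((n + 2 * H - (n - 2 * H) : ℕ) : ℝ) = 4 * H := by
        exact_mod_cast (by omega : n + 2 * H - (n - 2 * H) = 4 * H)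
      rw [h3]
      linarith
    have hone0 : 0 ≤ 2 * σ * H + 4 * η * H := (sum_nonneg fun _ _ => abs_nonneg _).trans hone
    have hcB : (#B : ℝ) ≤ H := by
      have := card_le_card hB
      rw [Nat.card_Icc, Nat.add_sub_cancel] at this
      exact_mod_cast this
    refine (sum_le_card_nsmul B _ (2 * σ * H + 4 * η * H) fun b hb => ?_).trans ?_
    · refine le_trans ?_ hone
      have hb' := mem_Icc.1 (hB hb)
      calc ∑ z ∈ Z, (fstr (n + z - b + Q) - fstr (n + z - b))
          ≤ ∑ z ∈ Z, |fstr (n + z - b + Q) - fstr (n + z - b)| :=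
            sum_le_sum fun z _ => le_abs_self _
        _ = ∑ y ∈ Z.image fun z => n + z - b, |fstr (y + Q) - fstr y| := by
            rw [sum_image]
            intro x _ y _ hxy
            simp only at hxy
            omega
        _ ≤ _ := by
            refine sum_le_sum_of_subset_of_nonneg (fun y hy => ?_) fun _ _ _ => abs_nonneg _
            obtain ⟨z, hz, rfl⟩ := mem_image.1 hy
            have := mem_range.1 (hZ hz)
            rw [mem_Ico]
            omega
    · rw [nsmul_eq_mul]
      gcongr
  have hu1 := (abs_le.1 (hunf' (n + Q) (by omega) le_rfl)).2
  have hu2 := (abs_le.1 (hunf' n le_rfl (by omega))).1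
  rw [hsplit] at hcard
  nlinarith

lemma norm_localTrigPoly_add_sub_le {d : ℕ} {c : Fin d → ℕ → ℂ} {α : Fin d → ℕ → ℝ}
    (hc : ∀ i n, ‖c i n‖ ≤ 1) {y Q : ℕ} {β : Fin d → ℝ} {δ : ℝ}
    (hcy : ∀ i, c i (y + Q) = c i y) (hαy : ∀ i, α i y = β i) (hαQ : ∀ i, α i (y + Q) = β i)
    (hδ : ∀ i, ‖((Q * β i : ℝ) : UnitAddCircle)‖ ≤ δ) :
    ‖localTrigPoly c α (y + Q) - localTrigPoly c α y‖ ≤ d * (2 * Real.pi * δ) := by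
  rw [localTrigPoly, localTrigPoly, ← sum_sub_distrib]
  refine (norm_sum_le _ _).trans ?_
  refine (sum_le_card_nsmul univ _ (2 * Real.pi * δ) fun i _ => ?_).trans (by simp)
  rw [hcy, hαy, hαQ]
  have e1 : c i y * e ((y + Q : ℕ) * β i) - c i y * e (y * β i) =
      c i y * e (y * β i) * (e (Q * β i) - 1) := by
    push_cast
    rw [add_mul, e_add]
    ring
  rw [e1, norm_mul, norm_mul, norm_e, mul_one]
  refine (mul_le_of_le_one_left (norm_nonneg _) (hc i y)).trans ?_
  refine (norm_e_sub_one_le _).trans ?_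
  have := Real.pi_pos
  gcongr
  exact hδ i

/-- A good period exists around `n` if the structured part is a trigonometric polynomial with
constant coefficients and frequencies up to a small `L¹` error, if its frequencies satisfy the
dichotomy, and if the remaining part is uniform. -/
lemma exists_isGoodPeriod {A : Set ℕ} {fstr funf : ℕ → ℝ}
    (hdec : ∀ n, A.indicator (fun _ => (1 : ℝ)) n = fstr n + funf n) {ε κ δ : ℝ} {K : ℕ}
    (hκ0 : 0 < κ)
    (hκ : ∀ (G : Type) [AddCommGroup G] [Fintype G] [DecidableEq G] (X Y Z : Finset G),
      (#{p ∈ X ×ˢ Y | p.1 + p.2 ∈ Z} : ℝ) ≤ κ * (Fintype.card G : ℝ) ^ 2 →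
      ∃ X' ⊆ X, ∃ Y' ⊆ Y, ∃ Z' ⊆ Z,
        (#(X \ X') : ℝ) ≤ ε / 2 * Fintype.card G ∧ (#(Y \ Y') : ℝ) ≤ ε / 2 * Fintype.card G ∧
        (#(Z \ Z') : ℝ) ≤ ε / 2 * Fintype.card G ∧ ∀ x ∈ X', ∀ y ∈ Y', x + y ∉ Z')
    (hε : 0 < ε) (hδε : δ ≤ ε) (hδ1 : δ ≤ 1)
    {d : ℕ} {c : Fin d → ℕ → ℂ} {α : Fin d → ℕ → ℝ} (hc : ∀ i n, ‖c i n‖ ≤ 1)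
    (hδd : d * (2 * Real.pi * δ) ≤ κ / 16) {H L n Q : ℕ} (hL : 0 < L) (hLH : L ≤ H)
    (hn : 8 * H ≤ n) (hK : (K : ℝ) ≤ ε / 2 * H)
    (hconst : ∀ i, ∀ y ∈ Ico (n - 2 * H) (n + 4 * H), c i y = c i n ∧ α i y = α i n)
    (hQK : K.factorial ∣ Q) (hHQ : H ≤ Q) (hQδ : (Q : ℝ) ≤ (1 + δ) * H)
    (hQα : ∀ i, ‖((Q * α i n : ℝ) : UnitAddCircle)‖ ≤ δ)
    (hstr : ∑ y ∈ Ico (n - 8 * H) (n + 8 * H), ‖localTrigPoly c α y - fstr y‖ ≤ κ / 8 * H)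
    (hunf : ∑ x ∈ Ico (n - 8 * H) (n + 8 * H), gowersU2Interval (fun n => (funf n : ℂ)) x L ≤
      κ / 288 * H) :
    IsGoodPeriod A H ε K n Q := by
  classical
  have hHR : (0 : ℝ) < H := by exact_mod_cast hL.trans_le hLH
  have hHQR : (H : ℝ) ≤ Q := by exact_mod_cast hHQ
  have hQH : Q ≤ 2 * H := by
    have : (Q : ℝ) ≤ (2 * H : ℕ) := by push_cast; nlinarith
    exact_mod_cast this
  refine ⟨hHQ, hQδ.trans (by gcongr), fun m hm hmK => (Nat.dvd_factorial hm hmK).trans hQK,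
    fun B hB => ?_⟩
  set Z : Finset ℕ := {z ∈ range Q | n + z ∉ A + B} with hZ
  set B' : Finset ℕ := {b ∈ Icc 1 H | b ∈ B} with hB'
  have hmemB : ∀ b, b ∈ B ↔ b ∈ B' := fun b => by
    rw [hB', mem_filter, mem_Icc]
    exact ⟨fun h => ⟨hB h, h⟩, fun h => h.2⟩
  set S : Finset (ℕ × ℕ) := {p ∈ Z ×ˢ B' | n + Q + p.1 - p.2 ∈ A} with hS
  have hcount : (#S : ℝ) ≤ κ * (Q : ℝ) ^ 2 := by
    have h := card_bad_pairs_le hdec (η := κ / 16) hL hLH hHQ hQH hn hstr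
      (fun y hy => ?_) hunf Z B' (filter_subset _ _) (filter_subset _ _) (fun z hz b hb h => ?_)
      S (fun p hp => ?_)
    · refine h.trans ?_
      have : (H : ℝ) ^ 2 ≤ (Q : ℝ) ^ 2 := by gcongr
      nlinarith
    · rw [mem_Ico] at hy
      have h0 := fun i => hconst i y (mem_Ico.2 (by omega))
      have h1 := fun i => hconst i (y + Q) (mem_Ico.2 (by omega))
      exact (norm_localTrigPoly_add_sub_le hc (β := fun i => α i n)
        (fun i => (h1 i).1.trans (h0 i).1.symm) (fun i => (h0 i).2) (fun i => (h1 i).2) hQα).trans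
        hδd
    · refine (mem_filter.1 hz).2 ?_
      have h1 := mem_Icc.1 (mem_filter.1 hb).1
      rw [show n + z = (n + z - b) + b by omega]
      exact Set.add_mem_add h (mem_filter.1 hb).2
    · rw [hS, mem_filter, mem_product] at hp
      exact ⟨hp.1.1, hp.1.2, hp.2⟩
  refine exists_isLocalSumsetPair hκ A B n K ((hL.trans_le hLH).trans_le hHQ)
    (hK.trans (by gcongr)) (hB.trans (Set.Icc_subset_Icc_right hHQ)) S
    (fun z b hz hzA hb hA => ?_) hcount
  rw [hS, mem_filter, mem_product, hZ, mem_filter, mem_range]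
  exact ⟨⟨⟨hz, hzA⟩, (hmemB b).1 hb⟩, hA⟩

end Local

section Density

open Finset

/-- For all large `s`, the proportion of `E s` in `[N_s]` is at most `ρ`. -/
def SmallAlong (N : ℕ → ℕ) (E : ℕ → Set ℕ) (ρ : ℝ) : Prop :=
  ∀ᶠ s in atTop, ((E s ∩ Set.Icc 1 (N s)).ncard : ℝ) ≤ ρ * N s

lemma SmallAlong.mono {N : ℕ → ℕ} {E F : ℕ → Set ℕ} {ρ : ℝ} (hF : SmallAlong N F ρ)
    (h : ∀ᶠ s in atTop, E s ∩ Set.Icc 1 (N s) ⊆ F s) : SmallAlong N E ρ := by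
  filter_upwards [hF, h] with s hs hsub
  refine le_trans ?_ hs
  exact_mod_cast Set.ncard_le_ncard (Set.subset_inter hsub Set.inter_subset_right)
    ((Set.finite_Icc _ _).inter_of_right _)

lemma SmallAlong.union {N : ℕ → ℕ} {E F : ℕ → Set ℕ} {ρ σ : ℝ} (hE : SmallAlong N E ρ)
    (hF : SmallAlong N F σ) : SmallAlong N (fun s => E s ∪ F s) (ρ + σ) := by
  filter_upwards [hE, hF] with s h1 h2
  rw [Set.union_inter_distrib_right, add_mul]
  have : (((E s ∩ Set.Icc 1 (N s)) ∪ (F s ∩ Set.Icc 1 (N s))).ncard : ℝ) ≤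
    (E s ∩ Set.Icc 1 (N s)).ncard + (F s ∩ Set.Icc 1 (N s)).ncard := by
    exact_mod_cast Set.ncard_union_le _ _
  linarith

lemma smallAlong_exists_lt {N : ℕ → ℕ} {E : ℕ → ℕ → Set ℕ}
    (hE : ∀ j, ∀ ρ > 0, SmallAlong N (E j) ρ) (J : ℕ) :
    ∀ ρ > 0, SmallAlong N (fun s => {n | ∃ j < J, n ∈ E j s}) ρ := by
  induction J with
  | zero =>
    intro ρ hρ
    refine Eventually.of_forall fun s => ?_
    simp only [not_lt_zero, false_and, exists_false, Set.ofPred_false, Set.empty_inter,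
      Set.ncard_empty, Nat.cast_zero]
    positivity
  | succ J ih =>
    intro ρ hρ
    have h := (ih (ρ / 2) (by positivity)).union (hE J (ρ / 2) (by positivity))
    rw [add_halves] at h
    refine h.mono (Eventually.of_forall ?_)
    rintro s n ⟨⟨j, hj, hn⟩, -⟩
    rcases Nat.lt_succ_iff_lt_or_eq.1 hj with h | rfl
    · exact Or.inl ⟨j, h, hn⟩
    · exact Or.inr hn

variable {N H : ℕ → ℕ}

lemma Prec.eventually_mul_le (hHN : Prec H N) (hN : ∀ s, 0 < N s) (C : ℝ) {ρ : ℝ} (hρ : 0 < ρ) :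
    ∀ᶠ s in atTop, C * H s ≤ ρ * N s := by
  have h1 : (0 : ℝ) < ρ / (|C| + 1) := by positivity
  filter_upwards [hHN.eventually_lt_const h1] with s hs
  have hNs : (0 : ℝ) < N s := by exact_mod_cast hN s
  rw [div_lt_div_iff₀ hNs (by positivity)] at hs
  have h2 : C * H s ≤ (|C| + 1) * H s := by
    gcongr
    linarith [le_abs_self C]
  linarith

/-- The points of `[N]` within `cH` of one of its ends are negligible. -/
lemma smallAlong_edges (hHN : Prec H N) (hN : ∀ s, 0 < N s) (hH : ∀ s, 0 < H s) (c : ℕ) {ρ : ℝ}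
    (hρ : 0 < ρ) : SmallAlong N (fun s => {n | n ≤ c * H s ∨ N s ≤ n + c * H s}) ρ := by
  filter_upwards [hHN.eventually_mul_le hN (2 * c + 1) hρ] with s hs
  refine le_trans ?_ hs
  have hsub : {n | n ≤ c * H s ∨ N s ≤ n + c * H s} ∩ Set.Icc 1 (N s) ⊆
      ((Icc 1 (c * H s) ∪ Icc (N s - c * H s) (N s) : Finset ℕ) : Set ℕ) := by
    rintro n ⟨h | h, h1⟩
    · rw [Set.mem_Icc] at h1
      exact mem_coe.2 (mem_union_left _ (mem_Icc.2 ⟨h1.1, h⟩))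
    · rw [Set.mem_Icc] at h1
      exact mem_coe.2 (mem_union_right _ (mem_Icc.2 ⟨by omega, h1.2⟩))
  have h1 := Set.ncard_le_ncard hsub (Finset.finite_toSet _)
  rw [Set.ncard_coe_finset] at h1
  have h2 := h1.trans (card_union_le _ _)
  rw [Nat.card_Icc, Nat.card_Icc] at h2
  have h3 := hH s
  have h4 : ({n | n ≤ c * H s ∨ N s ≤ n + c * H s} ∩ Set.Icc 1 (N s)).ncard ≤
    2 * (c * H s) + H s := by omega
  have h5 : (({n | n ≤ c * H s ∨ N s ≤ n + c * H s} ∩ Set.Icc 1 (N s)).ncard : ℝ) ≤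
    ((2 * (c * H s) + H s : ℕ) : ℝ) := by exact_mod_cast h4
  push_cast at h5
  linarith

/-- Shifts of sets of full proportion miss few points. -/
lemma FullProportion.smallAlong_shift {S : ℕ → Set ℕ} (hS : FullProportion N H S)
    (hHN : Prec H N) (hN : ∀ s, 0 < N s) (hH : ∀ s, 0 < H s) (c : ℕ) {a b : ℕ → ℕ}
    (ha : ∀ s, a s ≤ c * H s) (hb : ∀ s, b s ≤ c * H s) {ρ : ℝ} (hρ : 0 < ρ) :
    SmallAlong N (fun s => {n | n + a s - b s ∉ S s}) ρ := by
  have hmain : SmallAlong N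
      (fun s => {n | b s ≤ n ∧ n + a s - b s ∈ Set.Icc 1 (N s + 1 - H s) \ S s}) (ρ / 2) := by
    filter_upwards [hS.eventually_const_lt (show 1 - ρ / 2 < 1 by linarith),
      hHN.eventually_mul_le hN 1 one_pos] with s hs hHs
    rw [one_mul, one_mul, Nat.cast_le] at hHs
    have h1 : ({n | b s ≤ n ∧ n + a s - b s ∈ Set.Icc 1 (N s + 1 - H s) \ S s} ∩
        Set.Icc 1 (N s)).ncard ≤ (Set.Icc 1 (N s + 1 - H s) \ S s).ncard := by
      refine Set.ncard_le_ncard_of_injOn (fun n => n + a s - b s) (fun n hn => hn.1.2) ?_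
        ((Set.finite_Icc _ _).sdiff)
      intro x hx y hy hxy
      have := hx.1.1
      have := hy.1.1
      simp only at hxy
      omega
    have h2 := Set.ncard_inter_add_ncard_sdiff_eq_ncard (Set.Icc 1 (N s + 1 - H s)) (S s)
      (Set.finite_Icc _ _)
    have h3 : (Set.Icc 1 (N s + 1 - H s)).ncard = N s + 1 - H s := by
      rw [← coe_Icc, Set.ncard_coe_finset, Nat.card_Icc, Nat.add_sub_cancel]
    rw [h3, Set.inter_comm] at h2
    have hpos : (0 : ℝ) < (N s + 1 - H s : ℕ) := by exact_mod_cast (by omega)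
    rw [lt_div_iff₀ hpos] at hs
    have h4 : ((S s ∩ Set.Icc 1 (N s + 1 - H s)).ncard : ℝ) +
        (Set.Icc 1 (N s + 1 - H s) \ S s).ncard = (N s + 1 - H s : ℕ) := by exact_mod_cast h2
    have h5 : ((N s + 1 - H s : ℕ) : ℝ) ≤ N s := by
      have := hH s
      exact_mod_cast (by omega : N s + 1 - H s ≤ N s)
    have h6 : (({n | b s ≤ n ∧ n + a s - b s ∈ Set.Icc 1 (N s + 1 - H s) \ S s} ∩
        Set.Icc 1 (N s)).ncard : ℝ) ≤ (Set.Icc 1 (N s + 1 - H s) \ S s).ncard := by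
      exact_mod_cast h1
    nlinarith
  have h := hmain.union (smallAlong_edges hHN hN hH (c + 1) (half_pos hρ))
  rw [add_halves] at h
  refine h.mono (Eventually.of_forall fun s n hn => ?_)
  by_cases hedge : n ≤ (c + 1) * H s ∨ N s ≤ n + (c + 1) * H s
  · exact Or.inr hedge
  · left
    have h1 := ha s
    have h2 := hb s
    have h3 := hH s
    push Not at hedge
    rw [add_mul, one_mul] at hedge
    refine ⟨by omega, ?_, hn.1⟩
    rw [Set.mem_Icc]
    omega

/-- Markov's inequality for sums over windows of length `2cH`. -/
lemma smallAlong_window_sum {f : ℕ → ℕ → ℝ} (hf : ∀ s x, 0 ≤ f s x) (hHN : Prec H N)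
    (hN : ∀ s, 0 < N s) (hH : ∀ s, 0 < H s) (c : ℕ) {γ τ ρ : ℝ} (hτ : 0 < τ) (hρ : 0 < ρ)
    (hγ : 2 * c * γ ≤ τ * (ρ / 2))
    (hsum : ∀ᶠ s in atTop, ∑ x ∈ Icc 1 (N s), f s x ≤ γ * N s) :
    SmallAlong N
      (fun s => {n | ¬ ∑ x ∈ Ico (n - c * H s) (n + c * H s), f s x ≤ τ * H s}) ρ := by
  classical
  have hmain : SmallAlong N (fun s => {n | c * H s < n ∧ n + c * H s < N s ∧
      ¬ ∑ x ∈ Ico (n - c * H s) (n + c * H s), f s x ≤ τ * H s}) (ρ / 2) := by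
    filter_upwards [hsum] with s hs
    set F : Finset ℕ := {n ∈ Icc 1 (N s) | c * H s < n ∧ n + c * H s < N s ∧
      ¬ ∑ x ∈ Ico (n - c * H s) (n + c * H s), f s x ≤ τ * H s} with hF
    have e1 : {n | c * H s < n ∧ n + c * H s < N s ∧
      ¬ ∑ x ∈ Ico (n - c * H s) (n + c * H s), f s x ≤ τ * H s} ∩ Set.Icc 1 (N s) =
        (F : Set ℕ) := by
      ext n
      simp [hF, and_comm]
    rw [e1, Set.ncard_coe_finset]
    have hHs : (0 : ℝ) < H s := by exact_mod_cast hH s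
    have h1 : #F * (τ * H s) ≤ 2 * c * H s * (γ * N s) := by
      calc #F * (τ * H s) = ∑ n ∈ F, τ * H s := by rw [sum_const, nsmul_eq_mul]
        _ ≤ ∑ n ∈ F, ∑ x ∈ Icc 1 (N s),
              if x ∈ Ico (n - c * H s) (n + c * H s) then f s x else 0 := by
            refine sum_le_sum fun n hn => ?_
            obtain ⟨h1, h2, h3, h4⟩ := mem_filter.1 hn
            refine (not_le.1 h4).le.trans (le_of_eq ?_)
            rw [sum_ite_mem, inter_eq_right.2 fun x hx => ?_]
            rw [mem_Ico] at hx
            rw [mem_Icc]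
            omega
        _ = ∑ x ∈ Icc 1 (N s), ∑ n ∈ F,
              if x ∈ Ico (n - c * H s) (n + c * H s) then f s x else 0 := Finset.sum_comm
        _ ≤ ∑ x ∈ Icc 1 (N s), 2 * c * H s * f s x := by
            refine sum_le_sum fun x _ => ?_
            rw [← sum_filter, sum_const, nsmul_eq_mul]
            refine mul_le_mul_of_nonneg_right ?_ (hf s x)
            have hsub : {n ∈ F | x ∈ Ico (n - c * H s) (n + c * H s)} ⊆
                Ioc (x - c * H s) (x + c * H s) := by
              intro n hn
              obtain ⟨h0, h5⟩ := mem_filter.1 hn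
              obtain ⟨h1, h2, h3, h4⟩ := mem_filter.1 h0
              rw [mem_Ico] at h5
              rw [mem_Ioc]
              omega
            have h2 := card_le_card hsub
            rw [Nat.card_Ioc] at h2
            have h3 : #{n ∈ F | x ∈ Ico (n - c * H s) (n + c * H s)} ≤ 2 * (c * H s) := by omega
            rw [← mul_assoc] at h3
            exact_mod_cast h3
        _ = 2 * c * H s * ∑ x ∈ Icc 1 (N s), f s x := by rw [mul_sum]
        _ ≤ 2 * c * H s * (γ * N s) := by gcongr
    have hτH : 0 < τ * H s := by positivity
    refine le_of_mul_le_mul_right (h1.trans ?_) hτH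
    have h2 : (2 * c * γ) * (H s * N s) ≤ (τ * (ρ / 2)) * (H s * N s) := by gcongr
    linarith
  have h := hmain.union (smallAlong_edges hHN hN hH c (half_pos hρ))
  rw [add_halves] at h
  refine h.mono (Eventually.of_forall fun s n hn => ?_)
  by_cases hedge : n ≤ c * H s ∨ N s ≤ n + c * H s
  · exact Or.inr hedge
  · push Not at hedge
    exact Or.inl ⟨hedge.1, hedge.2, hn.1⟩

lemma eq_of_chain {R : Type*} (g : ℕ → R) {H : ℕ} (hH : 2 ≤ H) (m J : ℕ)
    (hg : ∀ j < J, ∀ x ∈ Set.Icc 1 H, ∀ y ∈ Set.Icc 1 H,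
      g (m + j * (H / 2) + x) = g (m + j * (H / 2) + y)) :
    ∀ y, m < y → y ≤ m + J * (H / 2) → g y = g (m + 1) := by
  have hstart : ∀ j < J, g (m + j * (H / 2) + 1) = g (m + 1) := by
    intro j
    induction j with
    | zero => intro _; simp
    | succ j ih =>
      intro hj
      rw [← ih (by omega), add_mul, one_mul, ← add_assoc, add_assoc _ (H / 2) 1]
      exact hg j (by omega) _ (by rw [Set.mem_Icc]; omega) _ (by rw [Set.mem_Icc]; omega)
  intro y hy hyJ
  have hh : 0 < H / 2 := by omega
  set j := (y - m - 1) / (H / 2) with hj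
  have hjJ : j < J := by
    rw [hj, Nat.div_lt_iff_lt_mul hh]
    omega
  have h1 : j * (H / 2) ≤ y - m - 1 := Nat.div_mul_le_self _ _
  have h2 : y - m - 1 < j * (H / 2) + H / 2 := Nat.lt_div_mul_add hh
  rw [← hstart j hjJ]
  have h3 := hg j hjJ (y - m - j * (H / 2)) (by rw [Set.mem_Icc]; omega) 1
    (by rw [Set.mem_Icc]; omega)
  rwa [show m + j * (H / 2) + (y - m - j * (H / 2)) = y by omega] at h3

/-- Functions that are locally constant at scale `H` at most points are locally constant on longer
windows at most points. -/
lemma smallAlong_not_const {R : Type*} {d : ℕ} {g : Fin d → ℕ → R}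
    (hg : FullProportion N H fun s => constancySet g (H s)) (hHN : Prec H N) (hN : ∀ s, 0 < N s)
    (hH : ∀ s, 0 < H s) (hH2 : ∀ᶠ s in atTop, 2 ≤ H s) {ρ : ℝ} (hρ : 0 < ρ) :
    SmallAlong N (fun s => {n | ¬ ∀ i, ∀ y ∈ Ico (n - 2 * H s) (n + 4 * H s), g i y = g i n})
      ρ := by
  have h1 := smallAlong_exists_lt (fun j => fun ρ' (hρ' : ρ' > 0) =>
    hg.smallAlong_shift hHN hN hH (j + 3) (a := fun s => j * (H s / 2)) (b := fun s => 3 * H s)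
      (fun s => by
        have : j * (H s / 2) ≤ j * H s := Nat.mul_le_mul_left j (Nat.div_le_self _ _)
        rw [add_mul]
        omega)
      (fun s => by rw [add_mul]; omega) hρ') 21 (ρ / 2) (half_pos hρ)
  have h := h1.union (smallAlong_edges hHN hN hH 4 (half_pos hρ))
  rw [add_halves] at h
  refine h.mono ?_
  filter_upwards [hH2] with s hs n hn
  by_contra hcon
  refine hn.1 fun i y hy => ?_
  simp only [Set.mem_union, Set.mem_ofPred_eq, not_or, not_exists, not_and, not_not] at hcon
  obtain ⟨hc, hedge, -⟩ := hcon
  have key := eq_of_chain (g i) hs (n - 3 * H s) 21 fun j hj x hx z hz => by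
    have := hc j hj i x hx z hz
    rwa [show n + j * (H s / 2) - 3 * H s = n - 3 * H s + j * (H s / 2) by omega] at this
  rw [mem_Ico] at hy
  rw [key y (by omega) (by omega), key n (by omega) (by omega)]

/-- For a good scale, good periods exist around most points. -/
theorem smallAlong_not_isGoodPeriod {A : Set ℕ} (hNpos : ∀ s, 0 < N s) (hHpos : ∀ s, 0 < H s)
    (hH : Tendsto H atTop atTop) (hHN : Prec H N) (hgood : IsU2GoodScaleForSet N H A)
    {ε : ℝ} (hε : 0 < ε) (K : ℕ) :
    SmallAlong N (fun s => {n | ¬ ∃ Q, IsGoodPeriod A (H s) ε K n Q}) ε := by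
  obtain ⟨fstr, funf, hdec, -, hstr, L, hLpos, -, hLH, hU⟩ := hgood
  obtain ⟨κ, hκ0, hκ⟩ := exists_arithmetic_removal (half_pos hε)
  set ρ := ε / 6 with hρ
  have hρ0 : 0 < ρ := by positivity
  have hpi := Real.pi_pos
  set ε₁ := κ / 8 * (ρ / 2) / 48 with hε₁
  have hε₁0 : 0 < ε₁ := by positivity
  obtain ⟨d, c, α, hc, ⟨v, hv, v', hv', hvv'⟩, hcond⟩ := hstr ε₁ hε₁0
  set δ := min (1 / 4) (min ε (κ / 16 / ((d + 1) * (2 * Real.pi)))) with hδ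
  have hδ0 : 0 < δ := by
    refine lt_min (by norm_num) (lt_min hε ?_)
    positivity
  have hδ4 : δ ≤ 1 / 4 := min_le_left _ _
  have hδε : δ ≤ ε := (min_le_right _ _).trans (min_le_left _ _)
  have hδd : d * (2 * Real.pi * δ) ≤ κ / 16 := by
    have h1 : δ ≤ κ / 16 / ((d + 1) * (2 * Real.pi)) := (min_le_right _ _).trans (min_le_right _ _)
    rw [le_div_iff₀ (by positivity)] at h1
    have : 0 ≤ δ * (2 * Real.pi) := by positivity
    nlinarith
  obtain ⟨C, hC1, H₀, hret⟩ := exists_return_time d (Nat.factorial_pos K) hδ0 hδ4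
  obtain ⟨hcα, hcc, hdich⟩ := hcond C hC1
  have hH2 : ∀ᶠ s in atTop, 2 ≤ H s := hH.eventually_ge_atTop 2
  have hLH' : ∀ᶠ s in atTop, L s ≤ H s := by
    filter_upwards [hLH.eventually_mul_le hHpos 1 one_pos] with s hs
    simpa using hs
  have E1 := smallAlong_edges hHN hNpos hHpos 9 hρ0
  have E2 := smallAlong_not_const hcα hHN hNpos hHpos hH2 hρ0
  have E3 := smallAlong_not_const hcc hHN hNpos hHpos hH2 hρ0
  have E4 := hdich.smallAlong_shift hHN hNpos hHpos 0 (a := fun _ => 0) (b := fun _ => 0)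
    (fun s => by simp) (fun s => by simp) hρ0
  have E5 := smallAlong_window_sum (f := fun _ y => ‖localTrigPoly c α y - fstr y‖)
    (fun _ _ => norm_nonneg _) hHN hNpos hHpos 8 (γ := 3 * ε₁) (τ := κ / 8) (by positivity) hρ0
    (by rw [hε₁]; push_cast; linarith) (by
      have hv'le : v' < 2 * ε₁ ^ 2 := by
        have h1 : Real.sqrt v' ≤ ε₁ := hvv' ▸ hv
        have h2 := (Real.sqrt_le_left hε₁0.le).1 h1
        have : 0 < ε₁ ^ 2 := by positivity
        linarith
      filter_upwards [hv'.eventually_lt_const hv'le] with s hs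
      have hNs : (0 : ℝ) < N s := by exact_mod_cast hNpos s
      rw [div_lt_iff₀ hNs] at hs
      have hpt : ∀ y ∈ Icc 1 (N s), ‖localTrigPoly c α y - fstr y‖ ≤
          ε₁ + ‖localTrigPoly c α y - fstr y‖ ^ 2 / ε₁ := by
        intro y _
        rw [← sub_le_iff_le_add', le_div_iff₀ hε₁0]
        nlinarith [sq_nonneg (‖localTrigPoly c α y - fstr y‖ - ε₁),
          norm_nonneg (localTrigPoly c α y - fstr y)]
      refine (sum_le_sum hpt).trans ?_
      rw [sum_add_distrib, sum_const, Nat.card_Icc, Nat.add_sub_cancel, nsmul_eq_mul, ← sum_div]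
      have h1 : (∑ y ∈ Icc 1 (N s), ‖localTrigPoly c α y - fstr y‖ ^ 2) / ε₁ ≤ 2 * ε₁ * N s := by
        rw [div_le_iff₀ hε₁0]
        nlinarith
      linarith)
  have E6 := smallAlong_window_sum
    (f := fun s x => if x + L s ≤ N s then gowersU2Interval (fun n => (funf n : ℂ)) x (L s) else 0)
    (fun s x => by split_ifs; exacts [gowersU2Interval_nonneg _ _ _, le_rfl]) hHN hNpos hHpos 8
    (γ := κ / 288 * (ρ / 2) / 16) (τ := κ / 288) (by positivity) hρ0
    (by push_cast; linarith) (by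
      have hpos : 0 < κ / 288 * (ρ / 2) / 16 := by positivity
      filter_upwards [hU.eventually_lt_const hpos, hLH',
        hHN.eventually_mul_le hNpos 1 one_pos] with s hs hLs hHs
      rw [one_mul, one_mul, Nat.cast_le] at hHs
      have h0 : (0 : ℝ) < (N s + 1 - L s : ℕ) := by exact_mod_cast (by omega)
      rw [div_lt_iff₀ h0] at hs
      have h1 : ((N s + 1 - L s : ℕ) : ℝ) ≤ N s := by
        have := hLpos s
        exact_mod_cast (by omega : N s + 1 - L s ≤ N s)
      calc _ = ∑ x ∈ Icc 1 (N s) with x + L s ≤ N s,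
            gowersU2Interval (fun n => (funf n : ℂ)) (x + 1 - 1) (L s) := by
            rw [sum_filter]
            rfl
        _ = ∑ y ∈ ((Icc 1 (N s)).filter fun x => x + L s ≤ N s).image fun x => x + 1,
            gowersU2Interval (fun n => (funf n : ℂ)) (y - 1) (L s) := by
            rw [sum_image fun x _ y _ h => by simpa using h]
        _ ≤ ∑ y ∈ Icc 1 (N s + 1 - L s),
            gowersU2Interval (fun n => (funf n : ℂ)) (y - 1) (L s) := by
            refine sum_le_sum_of_subset_of_nonneg (fun y hy => ?_)
              fun _ _ _ => gowersU2Interval_nonneg _ _ _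
            obtain ⟨x, hx, rfl⟩ := mem_image.1 hy
            rw [mem_filter, mem_Icc] at hx
            rw [mem_Icc]
            omega
        _ ≤ _ := hs.le
        _ ≤ _ := by gcongr)
  have hall := ((((E1.union E2).union E3).union E4).union E5).union E6
  rw [show ρ + ρ + ρ + ρ + ρ + ρ = ε by rw [hρ]; ring] at hall
  refine hall.mono ?_
  have hHbig : ∀ᶠ s in atTop, (K : ℝ) ≤ ε / 2 * H s := by
    have h1 : Tendsto (fun s => ε / 2 * (H s : ℝ)) atTop atTop :=
      (tendsto_natCast_atTop_atTop.comp hH).const_mul_atTop (by positivity)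
    exact h1.eventually_ge_atTop _
  filter_upwards [hLH', hH.eventually_ge_atTop H₀, hHbig] with s hLs hHs hKs n hn
  by_contra hcon
  refine hn.1 ?_
  simp only [Set.mem_union, Set.mem_ofPred_eq, not_or, not_not, not_le, add_zero, Nat.sub_zero]
    at hcon
  obtain ⟨⟨⟨⟨⟨⟨hn1, hn2⟩, hα⟩, hcst⟩, hdi⟩, hst⟩, hun⟩ := hcon
  obtain ⟨Q, hQK, hHQ, hQδ, hQα⟩ := hret (H s) hHs (fun i => α i n) hdi
  refine ⟨Q, exists_isGoodPeriod hdec hκ0 hκ hε hδε (by linarith) hc hδd (hLpos s) hLs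
    (by omega) hKs (fun i y hy => ⟨hcst i y hy, hα i y hy⟩) hQK hHQ hQδ hQα (not_lt.1 hst) ?_⟩
  refine le_of_eq_of_le (sum_congr rfl fun x hx => ?_) (not_lt.1 hun)
  rw [mem_Ico] at hx
  rw [if_pos (by omega)]

end Density

section Diagonal

/-- A slowly growing diagonal choice of parameters. -/
lemma exists_tendsto_of_forall_eventually {P : ℕ → ℕ → Prop} (h : ∀ k, ∀ᶠ s in atTop, P k s) :
    ∃ k : ℕ → ℕ, Tendsto k atTop atTop ∧ ∀ᶠ s in atTop, P (k s) s := by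
  classical
  obtain ⟨φ, hφ, hP⟩ := extraction_forall_of_eventually' (P := fun k m => ∀ s ≥ m, P k s)
    fun k => by
      obtain ⟨m, hm⟩ := eventually_atTop.1 (h k)
      exact ⟨m, fun b hb s hs => hm s (le_trans hb hs)⟩
  refine ⟨fun s => Nat.findGreatest (fun k => φ k ≤ s) s, ?_, ?_⟩
  · rw [tendsto_atTop]
    intro K
    filter_upwards [eventually_ge_atTop (φ K)] with s hs
    exact Nat.le_findGreatest ((hφ.le_apply).trans hs) hs
  · filter_upwards [eventually_ge_atTop (φ 0)] with s hs
    exact hP _ s (Nat.findGreatest_spec (P := fun k => φ k ≤ s) (Nat.zero_le s) hs)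

lemma MeetsEveryResidueClass.eventually_meetsResidueClassesUpTo {B : Set ℕ}
    (hB : MeetsEveryResidueClass B) {k : ℕ → ℕ} (hk : Tendsto k atTop atTop) (D : ℕ) :
    ∀ᶠ s in atTop, MeetsResidueClassesUpTo (B ∩ Set.Icc 1 (k s)) D := by
  have hex : ∀ m r : ℕ, ∃ b, 0 < m → b ∈ B ∧ 0 < b ∧ b ≡ r [MOD m] := by
    intro m r
    rcases Nat.eq_zero_or_pos m with rfl | hm
    · exact ⟨0, fun h => absurd h (lt_irrefl 0)⟩
    · obtain ⟨j, -, hj⟩ := hB m (r + m) hm (by omega)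
      refine ⟨_, fun _ => ⟨hj, by omega, ?_⟩⟩
      simp [Nat.ModEq, Nat.add_mod]
  choose b hb using hex
  filter_upwards [hk.eventually_ge_atTop
    (∑ m ∈ Finset.range (D + 1), ∑ r ∈ Finset.range m, b m r)] with s hs m hm hmD r
  obtain ⟨h1, h2, h3⟩ := hb m (r % m) hm
  refine ⟨b m (r % m), ⟨h1, h2, le_trans ?_ hs⟩, h3.trans (Nat.mod_modEq r m)⟩
  refine le_trans ?_ (Finset.single_le_sum (f := fun m => ∑ r ∈ Finset.range m, b m r)
    (fun _ _ => Nat.zero_le _) (Finset.mem_range.2 (Nat.lt_succ_of_le hmD)))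
  exact Finset.single_le_sum (f := fun r => b m r) (fun _ _ => Nat.zero_le _)
    (Finset.mem_range.2 (Nat.mod_lt r hm))

lemma Prec.tendsto_atTop {H : ℕ → ℕ} (hH : Prec (fun _ => 1) H) (hpos : ∀ s, 0 < H s) :
    Tendsto H atTop atTop := by
  rw [Filter.tendsto_atTop]
  intro C
  filter_upwards [hH.eventually_mul_le hpos C one_pos] with s hs
  simpa using hs

/-- A multiple of `k!` close to `H`. -/
lemma exists_multiple_factorial {H k : ℕ} {ε : ℝ} (hk : (k.factorial : ℝ) ≤ ε * H) :
    ∃ Q, H ≤ Q ∧ (Q : ℝ) ≤ (1 + ε) * H ∧ ∀ m, 0 < m → m ≤ k → m ∣ Q := by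
  refine ⟨k.factorial * (H / k.factorial + 1), (Nat.lt_mul_div_succ H k.factorial_pos).le, ?_,
    fun m hm hmk => (Nat.dvd_factorial hm hmk).trans (Dvd.intro _ rfl)⟩
  have h1 : k.factorial * (H / k.factorial + 1) ≤ H + k.factorial := by
    rw [mul_add, mul_one]
    exact Nat.add_le_add_right (Nat.mul_div_le _ _) _
  have h2 : ((k.factorial * (H / k.factorial + 1) : ℕ) : ℝ) ≤ H + k.factorial := by
    exact_mod_cast h1
  linarith

/-- Strictly increasing from some point on, with all earlier terms smaller. -/
lemma exists_strict_tail {N : ℕ → ℕ} (hNpos : ∀ s, 0 < N s) (hN : Prec N (fun s => N (s + 1)))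
    {P : ℕ → Prop} (hP : ∀ᶠ s in atTop, P s) :
    ∃ s₁, (∀ s ≥ s₁, P s) ∧ (∀ s ≥ s₁, N s < N (s + 1)) ∧ ∀ j ≤ s₁, N j ≤ N s₁ := by
  have hinc : ∀ᶠ s in atTop, N s < N (s + 1) := by
    filter_upwards [hN.eventually_lt_const one_pos] with s hs
    rw [div_lt_one (by exact_mod_cast hNpos _)] at hs
    exact_mod_cast hs
  obtain ⟨s₀, hs₀⟩ := eventually_atTop.1 (hP.and hinc)
  have hmono : ∀ t, N s₀ + t ≤ N (s₀ + t) := by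
    intro t
    induction t with
    | zero => rfl
    | succ t ih =>
      have := (hs₀ (s₀ + t) (by omega)).2
      rw [← add_assoc s₀ t 1]
      omega
  have hmono' : ∀ s ≥ s₀, ∀ t ≥ s, N s ≤ N t := by
    intro s hs t hst
    induction t, hst using Nat.le_induction with
    | base => rfl
    | succ t ht ih => exact ih.trans (hs₀ t (by omega)).2.le
  set M := ∑ j ∈ Finset.range s₀, N j with hM
  refine ⟨s₀ + M, fun s hs => (hs₀ s (by omega)).1, fun s hs => (hs₀ s (by omega)).2,
    fun j hj => ?_⟩
  rcases lt_or_ge j s₀ with h | h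
  · have h1 : N j ≤ M := Finset.single_le_sum (f := N) (fun _ _ => Nat.zero_le _)
      (Finset.mem_range.2 h)
    have := hmono M
    omega
  · exact hmono' j h _ hj

end Diagonal

end LocalSumset
end

open LocalSumset
theorem mainTheorem6 (A : Set ℕ) (δ : ℝ) (hδ : 0 < δ) (hA : HasDensity A δ)
    (N H : ℕ → ℕ) (hNpos : ∀ s, 0 < N s) (hHpos : ∀ s, 0 < H s)
    (hH : Prec (fun _ => 1) H) (hHN : Prec H N) (hN : Prec N (fun s => N (s + 1)))
    (hgood : IsU2GoodScaleForSet N H A) :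
    ∃ ε : ℕ → ℝ, Tendsto ε atTop (𝓝 0) ∧
    ∃ Q : ℕ → ℕ,
      (∀ s, ∀ n ∈ block N s, H s ≤ Q n ∧ (Q n : ℝ) ≤ (1 + ε s) * H s) ∧
      HighlyDivisible Q ∧
      ∀ B' : ℕ → Set ℕ, (∀ s, B' s ⊆ Set.Icc 1 (H s)) →
        ForAlmostAll N (fun s n =>
          ∃ An Bn : Set ℕ, IsLocalSumsetPair A (B' s) n (Q n) (ε s) An Bn) ∧
        ∀ B : Set ℕ, MeetsEveryResidueClass B → (∀ s, B' s = B ∩ Set.Icc 1 (H s)) →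
          ∃ D : ℕ → ℕ, Tendsto D atTop atTop ∧
            ForAlmostAll N (fun s n =>
              ∃ An Bn : Set ℕ, IsLocalSumsetPair A (B' s) n (Q n) (ε s) An Bn ∧
                MeetsResidueClassesUpTo Bn (D s)) := by
  classical
  have hHtop := hH.tendsto_atTop hHpos
  obtain ⟨k, hk, hkP⟩ := exists_tendsto_of_forall_eventually (P := fun k s =>
    (({n | ¬ ∃ Q, IsGoodPeriod A (H s) (1 / ((k : ℝ) + 1)) k n Q} ∩ Set.Icc 1 (N s)).ncard : ℝ) ≤
      1 / ((k : ℝ) + 1) * N s ∧ (k.factorial : ℝ) ≤ 1 / ((k : ℝ) + 1) * H s) fun k => by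
    have hpos : (0 : ℝ) < 1 / ((k : ℝ) + 1) := by positivity
    refine (smallAlong_not_isGoodPeriod hNpos hHpos hHtop hHN hgood hpos k).and ?_
    exact ((tendsto_natCast_atTop_atTop.comp hHtop).const_mul_atTop hpos).eventually_ge_atTop _
  obtain ⟨s₁, hP, hinc, hmax⟩ := exists_strict_tail hNpos hN hkP
  have hmono : ∀ s ≥ s₁, ∀ t ≥ s, N s ≤ N t := by
    intro s hs t hst
    induction t, hst using Nat.le_induction with
    | base => rfl
    | succ t ht ih => exact ih.trans (hinc t (by omega)).le
  have hblock : ∀ s > s₁, ∀ n, n ∈ block N s ↔ N (s - 1) < n ∧ n ≤ N s := by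
    intro s hs n
    obtain ⟨t, rfl⟩ : ∃ t, s = t + 1 := ⟨s - 1, by omega⟩
    rfl
  have huniq : ∀ n, ∀ s > s₁, ∀ t > s₁, n ∈ block N s → n ∈ block N t → s = t := by
    intro n s hs t ht hns hnt
    rw [hblock s hs] at hns
    rw [hblock t ht] at hnt
    rcases lt_trichotomy s t with h | h | h
    · have := hmono s hs.le (t - 1) (by omega)
      omega
    · exact h
    · have := hmono t ht.le (s - 1) (by omega)
      omega
  set η : ℕ → ℝ := fun s => 1 / ((k s : ℝ) + 1) with hη
  have hη0 : Tendsto η atTop (𝓝 0) :=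
    tendsto_one_div_add_atTop_nhds_zero_nat.comp hk
  set M := ∑ j ∈ Finset.range (s₁ + 1), H j with hM
  have hQex : ∀ n, ∃ Q : ℕ, (∀ s > s₁, n ∈ block N s →
      H s ≤ Q ∧ (Q : ℝ) ≤ (1 + η s) * H s ∧ (∀ m, 0 < m → m ≤ k s → m ∣ Q) ∧
      ((∃ Q', IsGoodPeriod A (H s) (η s) (k s) n Q') → IsGoodPeriod A (H s) (η s) (k s) n Q)) ∧
      ((∀ s > s₁, n ∉ block N s) → Q = M) := by
    intro n
    by_cases h : ∃ s > s₁, n ∈ block N s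
    · obtain ⟨s, hs, hns⟩ := h
      suffices ∃ Q : ℕ, H s ≤ Q ∧ (Q : ℝ) ≤ (1 + η s) * H s ∧ (∀ m, 0 < m → m ≤ k s → m ∣ Q) ∧
          ((∃ Q', IsGoodPeriod A (H s) (η s) (k s) n Q') →
            IsGoodPeriod A (H s) (η s) (k s) n Q) by
        obtain ⟨Q, hQ⟩ := this
        refine ⟨Q, fun t ht hnt => ?_, fun h => absurd hns (h s hs)⟩
        obtain rfl := huniq n s hs t ht hns hnt
        exact hQ
      by_cases hg : ∃ Q', IsGoodPeriod A (H s) (η s) (k s) n Q'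
      · obtain ⟨Q, hQ⟩ := hg
        exact ⟨Q, hQ.1, hQ.2.1, hQ.2.2.1, fun _ => hQ⟩
      · obtain ⟨Q, h1, h2, h3⟩ := exists_multiple_factorial (hP s (le_of_lt hs)).2
        exact ⟨Q, h1, h2, h3, fun h => absurd h hg⟩
    · exact ⟨M, fun s hs hns => absurd ⟨s, hs, hns⟩ h, fun _ => rfl⟩
  choose Q hQ hQM using hQex
  set ε : ℕ → ℝ := fun s => if s ≤ s₁ then (M : ℝ) else η s with hε
  have hεη : ∀ s > s₁, ε s = η s := fun s hs => if_neg (not_le.2 hs)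
  have hcount : ∀ P : ℕ → ℕ → Prop,
      (∀ᶠ s in atTop, ∀ n, IsGoodPeriod A (H s) (ε s) (k s) n (Q n) → P s n) →
      ForAlmostAll N P := by
    intro P hPP
    refine squeeze_zero' (Eventually.of_forall fun s => by positivity) ?_ hη0
    filter_upwards [hPP, eventually_gt_atTop s₁] with s hs hs₁
    have hNs : (0 : ℝ) < N s := by exact_mod_cast hNpos s
    rw [div_le_iff₀ hNs]
    refine le_trans ?_ (hP s hs₁.le).1
    have hsub : {n | n ∈ block N s ∧ ¬ P s n} ⊆
        {n | ¬ ∃ Q, IsGoodPeriod A (H s) (η s) (k s) n Q} ∩ Set.Icc 1 (N s) := by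
      rintro n ⟨hn, hnP⟩
      refine ⟨fun hg => hnP (hs n ?_), ?_⟩
      · rw [hεη s hs₁]
        exact (hQ n s hs₁ hn).2.2.2 hg
      · rw [hblock s hs₁] at hn
        exact ⟨by omega, hn.2⟩
    exact Nat.cast_le.2 <| Set.ncard_le_ncard hsub ((Set.finite_Icc _ _).inter_of_right _)
  refine ⟨ε, hη0.congr' ?_, Q, ?_, ?_, ?_⟩
  · filter_upwards [eventually_gt_atTop s₁] with s hs
    exact (hεη s hs).symm
  · intro s n hn
    rcases le_or_gt s s₁ with hs | hs
    · have hQn : Q n = M := hQM n fun t ht hnt => by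
        rw [hblock t ht] at hnt
        have h1 := hmono s₁ le_rfl (t - 1) (by omega)
        have h2 := hmax s hs
        have h3 : n ≤ N s := hn.2
        omega
      have h1 : H s ≤ M := Finset.single_le_sum (f := H) (fun _ _ => Nat.zero_le _)
        (Finset.mem_range.2 (by omega))
      have h2 : ε s = M := if_pos hs
      have h3 : (1 : ℝ) ≤ H s := by exact_mod_cast hHpos s
      refine ⟨hQn ▸ h1, ?_⟩
      rw [hQn, h2]
      nlinarith [(Nat.cast_nonneg M : (0 : ℝ) ≤ M)]
    · rw [hεη s hs]
      exact ⟨(hQ n s hs hn).1, (hQ n s hs hn).2.1⟩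
  · rw [HighlyDivisible, tendsto_atTop]
    intro C
    obtain ⟨S, hS⟩ := eventually_atTop.1 (hk.eventually_ge_atTop C)
    set S' := max S s₁ with hS'
    filter_upwards [eventually_gt_atTop (N S')] with n hn
    have hex : ∃ t, S' ≤ t ∧ n ≤ N t := by
      have hgrow : ∀ t, t ≤ N (S' + t) := by
        intro t
        induction t with
        | zero => exact Nat.zero_le _
        | succ t ih =>
          have := hinc (S' + t) (by omega)
          rw [← add_assoc]
          omega
      exact ⟨S' + n, by omega, hgrow n⟩
    obtain ⟨hf1, hf2⟩ := Nat.find_spec hex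
    set t := Nat.find hex with ht
    have htS : S' < t := by
      rcases hf1.lt_or_eq with h | h
      · exact h
      · rw [← h] at hf2; omega
    have htmin : N (t - 1) < n := by
      have := Nat.find_min hex (m := t - 1) (by omega)
      push Not at this
      exact this (by omega)
    have hts₁ : t > s₁ := by omega
    obtain ⟨h1, -, h3, -⟩ := hQ n t hts₁ ((hblock t hts₁ n).2 ⟨htmin, hf2⟩)
    have hne : {m : ℕ | 0 < m ∧ ¬ m ∣ Q n}.Nonempty := by
      have := hHpos t
      exact ⟨Q n + 1, Nat.succ_pos _, fun h => by
        have := Nat.le_of_dvd (by omega) h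
        omega⟩
    obtain ⟨h4, h5⟩ := Nat.sInf_mem hne
    by_contra! hlt
    have hkt := hS t (by omega)
    exact h5 (h3 _ h4 (by omega))
  · intro B' hB'
    refine ⟨hcount _ (Eventually.of_forall fun s n hn => ?_), fun B hB hBB' => ?_⟩
    · obtain ⟨An, Bn, h, -⟩ := hn.2.2.2 (B' s) (hB' s)
      exact ⟨An, Bn, h⟩
    · obtain ⟨D, hD, hDP⟩ := exists_tendsto_of_forall_eventually
        fun D => hB.eventually_meetsResidueClassesUpTo hk D
      refine ⟨D, hD, hcount _ ?_⟩
      filter_upwards [hDP, eventually_gt_atTop s₁] with s hs hs₁ n hn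
      obtain ⟨An, Bn, h, hBn⟩ := hn.2.2.2 (B' s) (hB' s)
      refine ⟨An, Bn, h, fun m hm hmD r => ?_⟩
      obtain ⟨b, hb, hbr⟩ := hs m hm hmD r
      refine ⟨b, hBn ⟨?_, hb.2⟩, hbr⟩
      rw [hBB']
      refine ⟨hb.1, hb.2.1, hb.2.2.trans ?_⟩
      have h1 := (hP s hs₁.le).2
      have h2 : 1 / ((k s : ℝ) + 1) ≤ 1 := by
        rw [div_le_one (by positivity)]
        linarith [(Nat.cast_nonneg (k s) : (0 : ℝ) ≤ k s)]
      have h3 : ((k s).factorial : ℝ) ≤ H s :=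
        h1.trans (mul_le_of_le_one_left (Nat.cast_nonneg _) h2)
      exact (Nat.self_le_factorial _).trans (by exact_mod_cast h3)
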